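/- **Setting.** Let $\mathcal X,\mathcal Y$ be finite sets with $d\ge 1$ elements each, and let $P,Q$ be transition (row-stochastic) matrices on $\mathcal X$ and $\mathcal Y$. $\Pi(p,q)$ is the set of couplings of $p$ and $q$. $\Pi_{TC}(P,Q)$ is the set of matrices $R$ indexed by $\mathcal X\times\mathcal Y$ with $R((x,y),\cdot)\in\Pi(P(x,\cdot),Q(y,\cdot))$ for all $(x,y)$. $H(R')$ is the vector of Shannon entropies $-\sum_{s'}R'(s,s')\log R'(s,s')$ of the rows of $R'$, and $\operatorname{argmin}$ of the vector $R'h-\frac1\xi H(R')$ is element-wise. **Algorithm.** For $h\in\mathbb R^{d^2}$ and $\xi,\varepsilon>0$, $\mathtt{EntropicTCI}(h,\xi,\varepsilon)$ returns the matrix whose row $(x,y)$ is $\mathtt{ApproxOT}(P(x,\cdot),Q(y,\cdot),h,\xi,\varepsilon)$, where $\mathtt{ApproxOT}(r,c,C,\xi,\varepsilon)$ does the following. 1. Restrict $r,c,C$ to the indices with $r_i>0$, $c_j>0$; put $J=\xi\|C\|_\infty-\log\min_{i,j}\{r_i,c_j\}$, $\varepsilon'=\varepsilon^2/(8J)$ and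 $K=e^{-\xi C}$ (entrywise). 2. (Sinkhorn) Start with $k=0$, $X_0=K/\|K\|_1$, $u=0$, $v=0$. While $\|X_k\mathbf 1-r\|_1+\|X_k^\top\mathbf 1-c\|_1>\varepsilon'$, increase $k$ by one, add $\log\big(r_i/(X_{k-1}\mathbf 1)_i\big)$ to $u_i$ for all $i$ if $k$ is odd, add $\log\big(c_j/(X_{k-1}^\top\mathbf 1)_j\big)$ to $v_j$ for all $j$ if $k$ is even, and put $X_k=\operatorname{diag}(e^{u})X_0\operatorname{diag}(e^{v})$. Let $F$ be the last $X_k$. 3. (Round) Multiply row $i$ of $F$ by $\min(r_i/(F\mathbf 1)_i,1)$ to get $F'$, then column $j$ of $F'$ by $\min(c_j/(F'^\top\mathbf 1)_j,1)$ to get $F''$; with $e_r=r-F''\mathbf 1$ and $e_c=c-F''^\top\mathbf 1$ form $F''+e_re_c^\top/\|e_r\|_1$ (where $0/0=0$). 4. Extend by zero to all indices and return. Time is the number of elementary steps on real numbers (arithmetic operations, comparisons, $\exp$, $\log$, storing an entry). **Theorem.** Let $P$ and $Q$ be aperiodic and irreducible, $h\in\mathbb R^{d^2}$, $\xi>0$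 and $\varepsilon>0$. Then $\mathtt{EntropicTCI}(h,\xi,\varepsilon)$ terminates and returns $\hat R\in\operatorname{ri}(\Pi_{TC}(P,Q))$ with $$\max_s\|\hat R(s,\cdot)-R^*(s,\cdot)\|_1\le\varepsilon\quad\text{for some}\quad R^*\in\operatorname*{argmin}_{R'\in\Pi_{TC}(P,Q)}R'h-\tfrac1\xi H(R'),$$ in $\tilde{\mathcal O}(d^4\varepsilon^{-4})$ time. Precisely, with $b$ the smallest positive entry of $P$ and $Q$, the time is at most $$A\,d^4\,\max(1,\varepsilon^{-1})^4\,\big(1+\log d+\xi\|h\|_\infty\big)\big(1+\xi\|h\|_\infty+\log b^{-1}\big)^2$$ for a universal constant $A$, which does not depend on $d,P,Q,h,\xi,\varepsilon$. -/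

import Mathlib

noncomputable section

/-! ### Real-number computations with a step count

A value of `Timed α` is the result of a computation over the reals together with the number of
elementary steps it takes (unit-cost arithmetic, comparison, `exp` and `log`).  A computation that
does not terminate has time `⊤`. -/

structure Timed (α : Type) where
  val : α
  time : ℕ∞

namespace Timed

instance : Monad Timed where
  pure a := ⟨a, 0⟩
  bind x f := ⟨(f x.val).val, x.time + (f x.val).time⟩

/-- One step of bookkeeping. -/
def tick : Timed Unit := ⟨(), 1⟩

def add (x y : ℝ) : Timed ℝ := ⟨x + y, 1⟩
def sub (x y : ℝ) : Timed ℝ := ⟨x - y, 1⟩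
def mul (x y : ℝ) : Timed ℝ := ⟨x * y, 1⟩
/-- Division, with `0 / 0 = 0`. -/
def div (x y : ℝ) : Timed ℝ := ⟨x / y, 1⟩
def min (x y : ℝ) : Timed ℝ := ⟨Min.min x y, 1⟩
def abs (x : ℝ) : Timed ℝ := ⟨|x|, 1⟩
def exp (x : ℝ) : Timed ℝ := ⟨Real.exp x, 1⟩
def log (x : ℝ) : Timed ℝ := ⟨Real.log x, 1⟩
def lt (x y : ℝ) : Timed Bool := ⟨decide (x < y), 1⟩

/-- A loop over the finite set `ι` that computes `f i` and stores it, for each `i`. -/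
def tabulate {ι α : Type} [Fintype ι] (f : ι → Timed α) : Timed (ι → α) :=
  ⟨fun i => (f i).val, ∑ i, ((f i).time + 1)⟩

/-- A loop over the finite set `ι` that computes `f i` and adds it to a running sum. -/
def sumOver {ι : Type} [Fintype ι] (f : ι → Timed ℝ) : Timed ℝ :=
  ⟨∑ i, (f i).val, ∑ i, ((f i).time + 1)⟩

/-- A loop over the finite nonempty set `ι` that computes `f i` and updates a running maximum. -/
def maxOver {ι : Type} [Fintype ι] (f : ι → Timed ℝ) : Timed ℝ :=
  ⟨⨆ i, (f i).val, ∑ i, ((f i).time + 1)⟩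

/-- A loop over the finite nonempty set `ι` that computes `f i` and updates a running minimum. -/
def minOver {ι : Type} [Fintype ι] (f : ι → Timed ℝ) : Timed ℝ :=
  ⟨⨅ i, (f i).val, ∑ i, ((f i).time + 1)⟩

/-- The loop `while guard s do s ← body s`.  It stops at the first iterate of `body` at which the
guard fails and is charged for all evaluations of the guard and the body; if there is no such
iterate, its time is `⊤`. -/
def whileLoop {σ : Type} (guard : σ → Timed Bool) (body : σ → Timed σ) (s : σ) : Timed σ :=
  let iter : ℕ → σ := fun k => (fun s' => (body s').val)^[k] s
  open Classical in
  if h : ∃ k, (guard (iter k)).val = false then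
    ⟨iter (Nat.find h),
      ∑ k ∈ Finset.range (Nat.find h + 1), (guard (iter k)).time +
        ∑ k ∈ Finset.range (Nat.find h), (body (iter k)).time⟩
  else ⟨s, ⊤⟩

end Timed

/-! ### The algorithms -/

section Algorithms

variable {m n : Type} [Fintype m] [Fintype n]

def rowSums (X : Matrix m n ℝ) : Timed (m → ℝ) :=
  Timed.tabulate fun i => Timed.sumOver fun j => pure (X i j)

def colSums (X : Matrix m n ℝ) : Timed (n → ℝ) :=
  Timed.tabulate fun j => Timed.sumOver fun i => pure (X i j)

/-- The `ℓ¹` distance of two vectors. -/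
def l1Dist (u v : m → ℝ) : Timed ℝ :=
  Timed.sumOver fun i => do Timed.abs (← Timed.sub (u i) (v i))

/-- The matrix `diag(x) A diag(y)`. -/
def diagScale (x : m → ℝ) (A : Matrix m n ℝ) (y : n → ℝ) : Timed (Matrix m n ℝ) :=
  Timed.tabulate fun i => Timed.tabulate fun j => do
    Timed.mul (← Timed.mul (x i) (A i j)) (y j)

/-- The variables `k`, `u^k`, `v^k`, `X_k` of Sinkhorn's algorithm. -/
structure SinkhornState (m n : Type) where
  k : ℕ
  u : m → ℝ
  v : n → ℝ
  X : Matrix m n ℝ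

/-- The test `‖X 1 - r‖₁ + ‖Xᵀ 1 - c‖₁ > ε'`. -/
def sinkhornGuard (r : m → ℝ) (c : n → ℝ) (ε' : ℝ) (st : SinkhornState m n) : Timed Bool := do
  let er ← l1Dist (← rowSums st.X) r
  let ec ← l1Dist (← colSums st.X) c
  Timed.lt ε' (← Timed.add er ec)

/-- One pass through the loop of Sinkhorn's algorithm: the rows are rescaled in odd passes and the
columns in even passes; `X₀` is the normalized kernel. -/
def sinkhornStep (X₀ : Matrix m n ℝ) (r : m → ℝ) (c : n → ℝ) (st : SinkhornState m n) :
    Timed (SinkhornState m n) := do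
  Timed.tick
  let k := st.k + 1
  if k % 2 = 1 then
    let rk ← rowSums st.X
    let du ← Timed.tabulate fun i => do Timed.log (← Timed.div (r i) (rk i))
    let u ← Timed.tabulate fun i => Timed.add (st.u i) (du i)
    let eu ← Timed.tabulate fun i => Timed.exp (u i)
    let ev ← Timed.tabulate fun j => Timed.exp (st.v j)
    let X ← diagScale eu X₀ ev
    return ⟨k, u, st.v, X⟩
  else
    let ck ← colSums st.X
    let dv ← Timed.tabulate fun j => do Timed.log (← Timed.div (c j) (ck j))
    let v ← Timed.tabulate fun j => Timed.add (st.v j) (dv j)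
    let eu ← Timed.tabulate fun i => Timed.exp (st.u i)
    let ev ← Timed.tabulate fun j => Timed.exp (v j)
    let X ← diagScale eu X₀ ev
    return ⟨k, st.u, v, X⟩

/-- `Sinkhorn(K, r, c, ε')`. -/
def sinkhorn (K : Matrix m n ℝ) (r : m → ℝ) (c : n → ℝ) (ε' : ℝ) : Timed (Matrix m n ℝ) := do
  let total ← Timed.sumOver fun i => Timed.sumOver fun j => Timed.abs (K i j)
  let X₀ ← Timed.tabulate fun i => Timed.tabulate fun j => Timed.div (K i j) total
  let u₀ ← Timed.tabulate fun _ : m => (pure 0 : Timed ℝ)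
  let v₀ ← Timed.tabulate fun _ : n => (pure 0 : Timed ℝ)
  let st ← Timed.whileLoop (sinkhornGuard r c ε') (sinkhornStep X₀ r c) ⟨0, u₀, v₀, X₀⟩
  return st.X

/-- `Round(F, Π(r, c))`. -/
def roundCoupling (F : Matrix m n ℝ) (r : m → ℝ) (c : n → ℝ) : Timed (Matrix m n ℝ) := do
  let r' ← rowSums F
  let x ← Timed.tabulate fun i => do Timed.min (← Timed.div (r i) (r' i)) 1
  let F' ← Timed.tabulate fun i => Timed.tabulate fun j => Timed.mul (x i) (F i j)
  let c' ← colSums F'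
  let y ← Timed.tabulate fun j => do Timed.min (← Timed.div (c j) (c' j)) 1
  let F'' ← Timed.tabulate fun i => Timed.tabulate fun j => Timed.mul (F' i j) (y j)
  let r'' ← rowSums F''
  let c'' ← colSums F''
  let errR ← Timed.tabulate fun i => Timed.sub (r i) (r'' i)
  let errC ← Timed.tabulate fun j => Timed.sub (c j) (c'' j)
  let e ← Timed.sumOver fun i => Timed.abs (errR i)
  Timed.tabulate fun i => Timed.tabulate fun j => do
    Timed.add (F'' i j) (← Timed.div (← Timed.mul (errR i) (errC j)) e)

/-- The body of `ApproxOT`, for marginals with positive entries. -/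
def approxOTPos (r : m → ℝ) (c : n → ℝ) (C : Matrix m n ℝ) (ξ ε : ℝ) :
    Timed (Matrix m n ℝ) := do
  let normC ← Timed.maxOver fun i => Timed.maxOver fun j => Timed.abs (C i j)
  let b ← Timed.min (← Timed.minOver fun i => pure (r i)) (← Timed.minOver fun j => pure (c j))
  let J ← Timed.sub (← Timed.mul ξ normC) (← Timed.log b)
  let ε' ← Timed.div (← Timed.mul ε ε) (← Timed.mul 8 J)
  let K ← Timed.tabulate fun i => Timed.tabulate fun j => do
    Timed.exp (← Timed.sub 0 (← Timed.mul ξ (C i j)))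
  let X' ← sinkhorn K r c ε'
  roundCoupling X' r c

/-- `ApproxOT(r, c, C, ξ, ε)`: restrict to the positive entries of `r` and `c`, solve there, and
extend the result by zero. -/
def approxOT (r : m → ℝ) (c : n → ℝ) (C : Matrix m n ℝ) (ξ ε : ℝ) : Timed (Matrix m n ℝ) := do
  let I ← Timed.tabulate fun i => Timed.lt 0 (r i)
  let J ← Timed.tabulate fun j => Timed.lt 0 (c j)
  let rPos ← Timed.tabulate fun i : {i // I i = true} => pure (r i)
  let cPos ← Timed.tabulate fun j : {j // J j = true} => pure (c j)
  let CPos ← Timed.tabulate fun i : {i // I i = true} =>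
    Timed.tabulate fun j : {j // J j = true} => pure (C i j)
  let X ← approxOTPos rPos cPos CPos ξ ε
  Timed.tabulate fun i => Timed.tabulate fun j =>
    pure (if h : I i = true ∧ J j = true then X ⟨i, h.1⟩ ⟨j, h.2⟩ else 0)

end Algorithms

/-- `EntropicTCI(h, ξ, ε)` for the transition matrices `P` and `Q`: row `(x, y)` of the result is
`ApproxOT(P(x,·), Q(y,·), h, ξ, ε)`. -/
def entropicTCI {𝒳 𝒴 : Type} [Fintype 𝒳] [Fintype 𝒴] (P : Matrix 𝒳 𝒳 ℝ) (Q : Matrix 𝒴 𝒴 ℝ)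
    (h : 𝒳 × 𝒴 → ℝ) (ξ ε : ℝ) : Timed (Matrix (𝒳 × 𝒴) (𝒳 × 𝒴) ℝ) :=
  Timed.tabulate fun s : 𝒳 × 𝒴 => do
    let X ← approxOT (P s.1) (Q s.2) (fun x' y' => h (x', y')) ξ ε
    Timed.tabulate fun s' : 𝒳 × 𝒴 => pure (X s'.1 s'.2)

/-! ### Transition couplings -/

/-- `P` is aperiodic: the greatest common divisor of `{k ≥ 1 : P^k(x, x) > 0}` is `1` for all `x`. -/
def IsAperiodic {𝒳 : Type} [Fintype 𝒳] [DecidableEq 𝒳] (P : Matrix 𝒳 𝒳 ℝ) : Prop :=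
  ∀ x, ∀ g : ℕ, (∀ k : ℕ, 1 ≤ k → 0 < (P ^ k) x x → g ∣ k) → g = 1

/-- The couplings of two vectors `p` and `q`. -/
def couplings {𝒳 𝒴 : Type} [Fintype 𝒳] [Fintype 𝒴] (p : 𝒳 → ℝ) (q : 𝒴 → ℝ) : Set (𝒳 × 𝒴 → ℝ) :=
  {r | (∀ s, 0 ≤ r s) ∧ (∀ x, ∑ y, r (x, y) = p x) ∧ (∀ y, ∑ x, r (x, y) = q y)}

/-- The set of transition couplings of `P` and `Q`. -/
def transitionCouplings {𝒳 𝒴 : Type} [Fintype 𝒳] [Fintype 𝒴]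
    (P : Matrix 𝒳 𝒳 ℝ) (Q : Matrix 𝒴 𝒴 ℝ) : Set (Matrix (𝒳 × 𝒴) (𝒳 × 𝒴) ℝ) :=
  {R | ∀ s, R s ∈ couplings (P s.1) (Q s.2)}

/-- The Shannon entropy of each row of `R`. -/
def rowEntropy {S : Type} [Fintype S] (R : Matrix S S ℝ) : S → ℝ :=
  fun s => -∑ s', R s s' * Real.log (R s s')

/-- The vector `R h - (1/ξ) H(R)`. -/
def entropicObjective {S : Type} [Fintype S] (h : S → ℝ) (ξ : ℝ) (R : Matrix S S ℝ) : S → ℝ :=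
  R.mulVec h - (1 / ξ) • rowEntropy R

/-- The minimizers over all transition couplings, elementwise, of `R h - (1/ξ) H(R)`. -/
def entropicMinimizers {𝒳 𝒴 : Type} [Fintype 𝒳] [Fintype 𝒴] (P : Matrix 𝒳 𝒳 ℝ)
    (Q : Matrix 𝒴 𝒴 ℝ) (h : 𝒳 × 𝒴 → ℝ) (ξ : ℝ) : Set (Matrix (𝒳 × 𝒴) (𝒳 × 𝒴) ℝ) :=
  {R | R ∈ transitionCouplings P Q ∧ ∀ R' ∈ transitionCouplings P Q, ∀ s,
    entropicObjective h ξ R s ≤ entropicObjective h ξ R' s}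

/-- The smallest positive entry of `P` and `Q`. -/
def minPosEntry {𝒳 𝒴 : Type} (P : Matrix 𝒳 𝒳 ℝ) (Q : Matrix 𝒴 𝒴 ℝ) : ℝ :=
  sInf {b : ℝ | 0 < b ∧ ((∃ x x', P x x' = b) ∨ (∃ y y', Q y y' = b))}

end

/-! The objective at `(x, y)` involves only row `(x, y)` (`entropicObjective_eq`), so the rows
decouple into entropic transport problems, and a matrix of row minimizers is an elementwise
minimizer. A zero marginal forces zero entries, so each problem lives on the supports, where the
marginals are bounded below. There the objective is, up to the factor `ξ` and a constant, the
divergence from the normalized Gibbs kernel `X₀` (`kernelDivergence_gibbsKernel`).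

Accuracy. Each Sinkhorn iterate is a diagonal scaling of `X₀` of mass one whose dual variables
oscillate by at most `R = 2ξ‖C‖∞ - log b`. In the symmetrized divergence of two such scalings the
kernel cancels and only marginals remain, so their squared ℓ¹ distance is at most `R` times the sum
of their marginal errors (`IsBalanced.sq_l1_sub_le`). Scalings with vanishing error are therefore
Cauchy. Their limit is a coupling, a minimizer by weak duality, and a scaling of error `δ` lies
within `√(R δ)` of it (`exists_optimal_coupling`). Since `R ≤ 2J`, the tolerance `ε' = ε²/(8J)`
makes this at most `ε/2`. Rounding moves the matrix by at most `ε'` (`roundCoupling_spec`), which is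
again at most `ε/2` outside trivial cases.

Time. After the first pass, each pass raises the dual value by a quarter of the squared marginal
error (`SinkhornInvariant.dualValue_mono`). The dual value starts at `0` and never exceeds `B = max
(-log X₀)`, which is `O(ξ‖C‖∞ + log d)`. Hence `O(1 + B J²/ε⁴)` passes suffice, each of cost
`O(d²)`, for each of `d²` rows.

Relative interior. Scaling and rounding keep every entry on the support positive, while the affine
hull fixes the marginals and the forced zeros; so a whole relative neighbourhood consists of
transition couplings. -/

/-! ### Inequalities for finite families of positive reals -/

/-- The squared Hellinger term `(√p - √q)²` lies in between: `log t ≤ t - 1` at `t = √(q/p)` bounds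
it above, and `(√p + √q)² ≤ 2(p + q)` bounds it below. -/
lemma sq_sub_div_add_le_klTerm {p q : ℝ} (hp : 0 < p) (hq : 0 < q) :
    (p - q) ^ 2 / (2 * (p + q)) ≤ p * (Real.log p - Real.log q) - p + q := by
  have h1 : Real.log q - Real.log p ≤ 2 * (√(q / p) - 1) := by
    have h := Real.log_le_sub_one_of_pos (Real.sqrt_pos.2 (div_pos hq hp))
    rw [Real.log_sqrt (div_pos hq hp).le, Real.log_div hq.ne' hp.ne'] at h
    linarith
  have hs : p * √(q / p) = √p * √q := by
    rw [Real.sqrt_div hq.le]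
    have := Real.mul_self_sqrt hp.le
    have hne : √p ≠ 0 := (Real.sqrt_pos.2 hp).ne'
    field_simp
    nlinarith
  have h2 : (√p - √q) ^ 2 ≤ p * (Real.log p - Real.log q) - p + q := by
    have := mul_le_mul_of_nonneg_left h1 hp.le
    nlinarith [Real.sq_sqrt hp.le, Real.sq_sqrt hq.le]
  refine le_trans ?_ h2
  have hP := Real.sq_sqrt hp.le
  have hQ := Real.sq_sqrt hq.le
  rw [div_le_iff₀ (by positivity)]
  have h3 : (p - q) ^ 2 = (√p - √q) ^ 2 * (√p + √q) ^ 2 := by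
    rw [← mul_pow, ← hP, ← hQ]; simp only [Real.sqrt_sq (Real.sqrt_nonneg _)]; ring
  rw [h3]
  exact mul_le_mul_of_nonneg_left (by nlinarith [sq_nonneg (√p - √q)]) (sq_nonneg _)

/-- By symmetry `q ≤ p`, and then this is `log (1 + t) ≥ 2t/(t + 2)` at `t = p/q - 1`. -/
lemma two_mul_sq_sub_div_add_le {p q : ℝ} (hp : 0 < p) (hq : 0 < q) :
    2 * ((p - q) ^ 2 / (p + q)) ≤ (p - q) * (Real.log p - Real.log q) := by
  wlog h : q ≤ p generalizing p q
  · have := this hq hp (le_of_not_ge h)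
    rw [add_comm q p, show (q - p) ^ 2 = (p - q) ^ 2 by ring] at this
    linarith
  have h1 := Real.le_log_one_add_of_nonneg (x := p / q - 1) (by
    rw [sub_nonneg, le_div_iff₀ hq]; linarith)
  rw [show 1 + (p / q - 1) = p / q by ring, Real.log_div hp.ne' hq.ne'] at h1
  have h2 : 2 * (p / q - 1) / (p / q - 1 + 2) = 2 * (p - q) / (p + q) := by
    rw [show p / q - 1 = (p - q) / q by field_simp, show (p - q) / q + 2 = (p + q) / q by
      field_simp; ring]
    field_simp
  rw [h2] at h1
  have := mul_le_mul_of_nonneg_left h1 (sub_nonneg.2 h)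
  calc _ = (p - q) * (2 * (p - q) / (p + q)) := by ring
    _ ≤ _ := this

/-- The nonnegative Kullback–Leibler term, for `p` possibly zero. -/
lemma klTerm_nonneg {p q : ℝ} (hp : 0 ≤ p) (hq : 0 < q) :
    0 ≤ p * (Real.log p - Real.log q) - p + q := by
  rcases hp.eq_or_lt with rfl | hp
  · simpa using hq.le
  · exact le_trans (by positivity) (sq_sub_div_add_le_klTerm hp hq)

section Families

variable {ι : Type} [Fintype ι]

/-- Cauchy–Schwarz with the weights `p + q`, whose total is `2`. -/
lemma sq_sum_abs_sub_le {p q : ι → ℝ} (hp : ∀ i, 0 < p i) (hq : ∀ i, 0 < q i)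
    (hp1 : ∑ i, p i = 1) (hq1 : ∑ i, q i = 1) :
    (∑ i, |p i - q i|) ^ 2 ≤ 2 * ∑ i, (p i - q i) ^ 2 / (p i + q i) := by
  have h := Finset.sq_sum_div_le_sum_sq_div Finset.univ (fun i => |p i - q i|)
    (g := fun i => p i + q i) (fun i _ => add_pos (hp i) (hq i))
  rw [Finset.sum_add_distrib, hp1, hq1] at h
  simp only [sq_abs] at h
  linarith

/-- A weak form of Pinsker's inequality. -/
lemma sq_sum_abs_sub_le_kl {p q : ι → ℝ} (hp : ∀ i, 0 < p i) (hq : ∀ i, 0 < q i)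
    (hp1 : ∑ i, p i = 1) (hq1 : ∑ i, q i = 1) :
    (∑ i, |p i - q i|) ^ 2 ≤ 4 * ∑ i, p i * (Real.log (p i) - Real.log (q i)) := by
  refine (sq_sum_abs_sub_le hp hq hp1 hq1).trans ?_
  have h := Finset.sum_le_sum fun i (_ : i ∈ Finset.univ) =>
    sq_sub_div_add_le_klTerm (hp i) (hq i)
  rw [Finset.sum_add_distrib, Finset.sum_sub_distrib, hp1, hq1] at h
  have h2 : ∑ i, (p i - q i) ^ 2 / (2 * (p i + q i)) =
      (1 / 2) * ∑ i, (p i - q i) ^ 2 / (p i + q i) := by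
    rw [Finset.mul_sum]
    refine Finset.sum_congr rfl fun i _ => ?_
    have := (add_pos (hp i) (hq i)).ne'
    field_simp
  linarith

/-- The symmetrized form of Pinsker's inequality. -/
lemma sq_sum_abs_sub_le_jeffreys {p q : ι → ℝ} (hp : ∀ i, 0 < p i) (hq : ∀ i, 0 < q i)
    (hp1 : ∑ i, p i = 1) (hq1 : ∑ i, q i = 1) :
    (∑ i, |p i - q i|) ^ 2 ≤ ∑ i, (p i - q i) * (Real.log (p i) - Real.log (q i)) := by
  refine (sq_sum_abs_sub_le hp hq hp1 hq1).trans ?_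
  rw [Finset.mul_sum]
  exact Finset.sum_le_sum fun i _ => two_mul_sq_sub_div_add_le (hp i) (hq i)

/-- Gibbs' inequality. -/
lemma sum_mul_log_le {p q : ι → ℝ} (hp : ∀ i, 0 ≤ p i) (hq : ∀ i, 0 < q i)
    (hp1 : ∑ i, p i = 1) (hq1 : ∑ i, q i = 1) :
    ∑ i, p i * Real.log (q i) ≤ ∑ i, p i * Real.log (p i) := by
  have h := Finset.sum_nonneg fun i (_ : i ∈ Finset.univ) => klTerm_nonneg (hp i) (hq i)
  rw [Finset.sum_add_distrib, Finset.sum_sub_distrib, hp1, hq1] at h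
  simp only [mul_sub, Finset.sum_sub_distrib] at h
  linarith

/-- A vector of zero sum pairs with a vector of oscillation at most `W`. -/
lemma sum_mul_le_of_sum_eq_zero [Nonempty ι] {a w : ι → ℝ} {W : ℝ} (ha : ∑ i, a i = 0)
    (hw : ∀ i j, w i - w j ≤ W) : ∑ i, a i * w i ≤ W / 2 * ∑ i, |a i| := by
  obtain ⟨M, hM⟩ := Finite.exists_max w
  obtain ⟨N, hN⟩ := Finite.exists_min w
  -- Subtracting a constant from `w` is free because `a` sums to zero; the midpoint of the range
  -- leaves values of modulus at most `W / 2`.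
  set μ := (w M + w N) / 2
  have h1 : ∑ i, a i * w i = ∑ i, a i * (w i - μ) := by
    simp only [mul_sub, Finset.sum_sub_distrib, ← Finset.sum_mul, ha]; ring
  rw [h1, Finset.mul_sum]
  refine Finset.sum_le_sum fun i _ => ?_
  have h2 : |w i - μ| ≤ W / 2 := by
    rw [abs_le]
    constructor <;> simp only [μ] <;> linarith [hM i, hN i, hw M N]
  calc a i * (w i - μ) ≤ |a i| * |w i - μ| := by rw [← abs_mul]; exact le_abs_self _
    _ ≤ |a i| * (W / 2) := mul_le_mul_of_nonneg_left h2 (abs_nonneg _)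
    _ = _ := by ring

lemma sum_posPart_of_sum_eq_zero {a : ι → ℝ} (ha : ∑ i, a i = 0) :
    ∑ i, max (a i) 0 = (∑ i, |a i|) / 2 := by
  have h : ∀ i, max (a i) 0 = (|a i| + a i) / 2 := fun i => by
    rcases le_total 0 (a i) with h | h
    · rw [max_eq_left h, abs_of_nonneg h]; ring
    · rw [max_eq_right h, abs_of_nonpos h]; ring
  simp only [h, ← Finset.sum_div, Finset.sum_add_distrib, ha, add_zero]

end Families

/-! ### Diagonal scalings of a positive matrix -/

section Scaling

variable {m n : Type}

/-- The matrix `diag(exp u) X₀ diag(exp v)`. -/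
noncomputable def diagonalScaling (X₀ : Matrix m n ℝ) (u : m → ℝ) (v : n → ℝ) : Matrix m n ℝ :=
  fun i j => Real.exp (u i) * X₀ i j * Real.exp (v j)

lemma diagonalScaling_pos {X₀ : Matrix m n ℝ} (hX₀ : ∀ i j, 0 < X₀ i j) (u : m → ℝ) (v : n → ℝ)
    (i : m) (j : n) : 0 < diagonalScaling X₀ u v i j :=
  mul_pos (mul_pos (Real.exp_pos _) (hX₀ i j)) (Real.exp_pos _)

lemma log_diagonalScaling {X₀ : Matrix m n ℝ} (hX₀ : ∀ i j, 0 < X₀ i j) (u : m → ℝ) (v : n → ℝ)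
    (i : m) (j : n) :
    Real.log (diagonalScaling X₀ u v i j) = u i + Real.log (X₀ i j) + v j := by
  rw [diagonalScaling, Real.log_mul (mul_pos (Real.exp_pos _) (hX₀ i j)).ne' (Real.exp_pos _).ne',
    Real.log_mul (Real.exp_pos _).ne' (hX₀ i j).ne', Real.log_exp, Real.log_exp]

variable [Fintype m] [Fintype n]

/-- The total violation of the marginal constraints. -/
def marginalError (r : m → ℝ) (c : n → ℝ) (X : Matrix m n ℝ) : ℝ :=
  ∑ i, |∑ j, X i j - r i| + ∑ j, |∑ i, X i j - c j|

lemma marginalError_nonneg (r : m → ℝ) (c : n → ℝ) (X : Matrix m n ℝ) :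
    0 ≤ marginalError r c X :=
  add_nonneg (Finset.sum_nonneg fun _ _ => abs_nonneg _) (Finset.sum_nonneg fun _ _ => abs_nonneg _)

/-- Nonnegative matrices with row sums `r` and column sums `c`. -/
structure IsCoupling (r : m → ℝ) (c : n → ℝ) (X : Matrix m n ℝ) : Prop where
  nonneg : ∀ i j, 0 ≤ X i j
  row : ∀ i, ∑ j, X i j = r i
  col : ∀ j, ∑ i, X i j = c j

/-- The divergence of `X` from the kernel `X₀`, for matrices of equal mass. -/
noncomputable def kernelDivergence (X₀ X : Matrix m n ℝ) : ℝ :=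
  ∑ i, ∑ j, X i j * (Real.log (X i j) - Real.log (X₀ i j))

/-- The scaling by `u`, `v` has mass one, and `u`, `v` have oscillation at most `R`. -/
structure IsBalanced (X₀ : Matrix m n ℝ) (R : ℝ) (u : m → ℝ) (v : n → ℝ) : Prop where
  osc_left : ∀ i i', u i - u i' ≤ R
  osc_right : ∀ j j', v j - v j' ≤ R
  mass : ∑ i, ∑ j, diagonalScaling X₀ u v i j = 1

lemma sum_sum_mul_left (A : Matrix m n ℝ) (w : m → ℝ) :
    ∑ i, ∑ j, A i j * w i = ∑ i, (∑ j, A i j) * w i := by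
  simp only [Finset.sum_mul]

lemma sum_sum_mul_right (A : Matrix m n ℝ) (w : n → ℝ) :
    ∑ i, ∑ j, A i j * w j = ∑ j, (∑ i, A i j) * w j := by
  rw [Finset.sum_comm]; simp only [Finset.sum_mul]

variable {X₀ : Matrix m n ℝ} {r : m → ℝ} {c : n → ℝ} {R : ℝ} {u u' : m → ℝ} {v v' : n → ℝ}

lemma IsCoupling.sum_eq {X : Matrix m n ℝ} (hX : IsCoupling r c X) (hr : ∑ i, r i = 1) :
    ∑ i, ∑ j, X i j = 1 := by
  simp only [hX.row, hr]

/-- Weak duality. -/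
lemma IsBalanced.dual_le {X : Matrix m n ℝ} (hX₀ : ∀ i j, 0 < X₀ i j) (h : IsBalanced X₀ R u v)
    (hX : IsCoupling r c X) (hr : ∑ i, r i = 1) :
    ∑ i, r i * u i + ∑ j, c j * v j ≤ kernelDivergence X₀ X := by
  -- Gibbs' inequality with the scaling as reference: its logarithm splits as `u i + log (X₀ i j) +
  -- v j`, and `u`, `v` see only the marginals of `X`.
  have key := sum_mul_log_le (ι := m × n) (p := fun s => X s.1 s.2)
    (q := fun s => diagonalScaling X₀ u v s.1 s.2) (fun s => hX.nonneg _ _)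
    (fun s => diagonalScaling_pos hX₀ u v _ _)
    (by rw [Fintype.sum_prod_type]; exact hX.sum_eq hr)
    (by rw [Fintype.sum_prod_type]; exact h.mass)
  rw [Fintype.sum_prod_type, Fintype.sum_prod_type] at key
  simp only [log_diagonalScaling hX₀, mul_add, Finset.sum_add_distrib] at key
  rw [sum_sum_mul_left X u, sum_sum_mul_right X v] at key
  simp only [hX.row, hX.col] at key
  simp only [kernelDivergence, mul_sub, Finset.sum_sub_distrib]
  linarith

lemma continuous_kernelDivergence (X₀ : Matrix m n ℝ) : Continuous (kernelDivergence X₀) := by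
  unfold kernelDivergence
  simp only [mul_sub]
  refine continuous_finsetSum _ fun i _ => continuous_finsetSum _ fun j _ => ?_
  have hc : Continuous fun X : Matrix m n ℝ => X i j :=
    (continuous_apply j).comp (continuous_apply i)
  exact (Real.continuous_mul_log.comp hc).sub (hc.mul continuous_const)

lemma continuous_marginalError (r : m → ℝ) (c : n → ℝ) : Continuous (marginalError r c) := by
  unfold marginalError
  have hc : ∀ i j, Continuous fun X : Matrix m n ℝ => X i j := fun i j =>
    (continuous_apply j).comp (continuous_apply i)
  fun_prop

lemma IsBalanced.nonneg [Nonempty m] (h : IsBalanced X₀ R u v) : 0 ≤ R := by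
  simpa using h.osc_left (Classical.arbitrary m) (Classical.arbitrary m)

variable [Nonempty m] [Nonempty n]

/-- In `log S - log S'` the kernel cancels and leaves `(u - u') + (v - v')`, so the symmetrized
divergence pairs these with differences of marginals. Passing through `r` and `c` bounds those
differences by the two marginal errors. -/
lemma IsBalanced.sq_l1_sub_le (hX₀ : ∀ i j, 0 < X₀ i j) (h : IsBalanced X₀ R u v)
    (h' : IsBalanced X₀ R u' v') :
    (∑ i, ∑ j, |diagonalScaling X₀ u v i j - diagonalScaling X₀ u' v' i j|) ^ 2 ≤
      R * (marginalError r c (diagonalScaling X₀ u v) +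
        marginalError r c (diagonalScaling X₀ u' v')) := by
  set S := diagonalScaling X₀ u v with hS
  set S' := diagonalScaling X₀ u' v' with hS'
  have hpos := diagonalScaling_pos hX₀ u v
  have hpos' := diagonalScaling_pos hX₀ u' v'
  have key := sq_sum_abs_sub_le_jeffreys (ι := m × n) (p := fun s => S s.1 s.2)
    (q := fun s => S' s.1 s.2) (fun s => hpos _ _) (fun s => hpos' _ _)
    (by rw [Fintype.sum_prod_type]; exact h.mass) (by rw [Fintype.sum_prod_type]; exact h'.mass)
  rw [Fintype.sum_prod_type, Fintype.sum_prod_type] at key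
  refine key.trans ?_
  have e1 : ∀ i j, (S i j - S' i j) * (Real.log (S i j) - Real.log (S' i j)) =
      (S i j - S' i j) * (u i - u' i) + (S i j - S' i j) * (v j - v' j) := fun i j => by
    rw [hS, hS', log_diagonalScaling hX₀, log_diagonalScaling hX₀]; ring
  rw [Finset.sum_congr rfl fun i _ => Finset.sum_congr rfl fun j _ => e1 i j]
  simp only [Finset.sum_add_distrib]
  have el := sum_sum_mul_left (fun i j => S i j - S' i j) (fun i => u i - u' i)
  have er := sum_sum_mul_right (fun i j => S i j - S' i j) (fun j => v j - v' j)
  rw [el, er]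
  have hmass : ∑ i, ∑ j, (S i j - S' i j) = 0 := by
    simp only [Finset.sum_sub_distrib]; rw [h.mass, h'.mass, sub_self]
  -- A difference of two dual variables oscillates by at most `2 * R`, and the half in the pairing
  -- bound brings this back to `R`.
  have b1 := sum_mul_le_of_sum_eq_zero (W := 2 * R) (w := fun i => u i - u' i) hmass
    (fun i j => by linarith [h.osc_left i j, h'.osc_left j i])
  have b2 := sum_mul_le_of_sum_eq_zero (W := 2 * R) (w := fun j => v j - v' j)
    (by rw [Finset.sum_comm] at hmass; exact hmass)
    (fun i j => by linarith [h.osc_right i j, h'.osc_right j i])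
  have hR := h.nonneg
  have t1 : ∑ i, |∑ j, (S i j - S' i j)| ≤
      ∑ i, |∑ j, S i j - r i| + ∑ i, |∑ j, S' i j - r i| := by
    rw [← Finset.sum_add_distrib]
    refine Finset.sum_le_sum fun i _ => ?_
    rw [Finset.sum_sub_distrib, abs_sub_comm (∑ j, S' i j)]
    exact abs_sub_le _ _ _
  have t2 : ∑ j, |∑ i, (S i j - S' i j)| ≤
      ∑ j, |∑ i, S i j - c j| + ∑ j, |∑ i, S' i j - c j| := by
    rw [← Finset.sum_add_distrib]
    refine Finset.sum_le_sum fun j _ => ?_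
    rw [Finset.sum_sub_distrib, abs_sub_comm (∑ i, S' i j)]
    exact abs_sub_le _ _ _
  have := mul_le_mul_of_nonneg_left (add_le_add t1 t2) hR
  simp only [marginalError]
  linarith

/-- The divergence of a scaling is exactly its own marginals paired with `u` and `v`; replacing them
by `r` and `c` is a zero-sum perturbation. Together with `IsBalanced.dual_le` this makes a scaling
of small marginal error nearly optimal. -/
lemma IsBalanced.kernelDivergence_le (hX₀ : ∀ i j, 0 < X₀ i j) (h : IsBalanced X₀ R u v)
    (hr : ∑ i, r i = 1) (hc : ∑ j, c j = 1) :
    kernelDivergence X₀ (diagonalScaling X₀ u v) ≤ ∑ i, r i * u i + ∑ j, c j * v j +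
      R / 2 * marginalError r c (diagonalScaling X₀ u v) := by
  set S := diagonalScaling X₀ u v with hS
  have e : kernelDivergence X₀ S = ∑ i, (∑ j, S i j) * u i + ∑ j, (∑ i, S i j) * v j := by
    rw [← sum_sum_mul_left, ← sum_sum_mul_right, kernelDivergence, ← Finset.sum_add_distrib]
    refine Finset.sum_congr rfl fun i _ => ?_
    rw [← Finset.sum_add_distrib]
    refine Finset.sum_congr rfl fun j _ => ?_
    rw [hS, log_diagonalScaling hX₀]; ring
  have hm : ∑ i, ∑ j, S i j = 1 := h.mass
  have hm' : ∑ j, ∑ i, S i j = 1 := by rw [Finset.sum_comm]; exact hm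
  have b1 := sum_mul_le_of_sum_eq_zero (a := fun i => ∑ j, S i j - r i) (w := u)
    (by rw [Finset.sum_sub_distrib, hm, hr, sub_self]) h.osc_left
  have b2 := sum_mul_le_of_sum_eq_zero (a := fun j => ∑ i, S i j - c j) (w := v)
    (by rw [Finset.sum_sub_distrib, hm', hc, sub_self]) h.osc_right
  simp only [sub_mul, Finset.sum_sub_distrib] at b1 b2
  rw [e, marginalError]
  linarith

/-- If balanced scalings have arbitrarily small marginal errors, they converge to a coupling of
least divergence, at a rate controlled by the marginal error. -/
lemma exists_optimal_coupling (hX₀ : ∀ i j, 0 < X₀ i j) (hr : ∑ i, r i = 1) (hc : ∑ j, c j = 1)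
    (H : ∀ δ > 0, ∃ u v, IsBalanced X₀ R u v ∧ marginalError r c (diagonalScaling X₀ u v) ≤ δ) :
    ∃ X, IsCoupling r c X ∧
      (∀ X', IsCoupling r c X' → kernelDivergence X₀ X ≤ kernelDivergence X₀ X') ∧
      ∀ u v, IsBalanced X₀ R u v → (∑ i, ∑ j, |diagonalScaling X₀ u v i j - X i j|) ^ 2 ≤
        R * marginalError r c (diagonalScaling X₀ u v) := by
  choose u v hb he using fun k : ℕ => H (1 / ((k : ℝ) + 1)) (by positivity)
  set S : ℕ → Matrix m n ℝ := fun k => diagonalScaling X₀ (u k) (v k) with hS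
  have hR : 0 ≤ R := (hb 0).nonneg
  have hlim : Filter.Tendsto (fun k : ℕ => 1 / ((k : ℝ) + 1)) Filter.atTop (nhds 0) :=
    tendsto_one_div_add_atTop_nhds_zero_nat
  have herr : Filter.Tendsto (fun k => marginalError r c (S k)) Filter.atTop (nhds 0) :=
    squeeze_zero (fun k => marginalError_nonneg _ _ _) he hlim
  have hcau : ∀ i j, CauchySeq fun k => S k i j := fun i j => by
    refine cauchySeq_of_le_tendsto_0 (fun k : ℕ => √(R * (2 * (1 / ((k : ℝ) + 1))))) ?_ ?_
    · intro k l N hk hl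
      have mono : ∀ k : ℕ, N ≤ k → marginalError r c (S k) ≤ 1 / ((N : ℝ) + 1) := fun k hk =>
        (he k).trans (one_div_le_one_div_of_le (by positivity) (by exact_mod_cast by omega))
      refine Real.le_sqrt_of_sq_le ?_
      have h1 := (hb k).sq_l1_sub_le (r := r) (c := c) hX₀ (hb l)
      have h2 : dist (S k i j) (S l i j) ≤ ∑ i, ∑ j, |S k i j - S l i j| := by
        rw [Real.dist_eq]
        exact (Finset.single_le_sum (f := fun j => |S k i j - S l i j|)
          (fun _ _ => abs_nonneg _) (Finset.mem_univ j)).trans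
          (Finset.single_le_sum (f := fun i => ∑ j, |S k i j - S l i j|)
            (fun _ _ => Finset.sum_nonneg fun _ _ => abs_nonneg _) (Finset.mem_univ i))
      calc _ ≤ (∑ i, ∑ j, |S k i j - S l i j|) ^ 2 := pow_le_pow_left₀ dist_nonneg h2 2
        _ ≤ _ := h1
        _ ≤ _ := mul_le_mul_of_nonneg_left (by linarith [mono k hk, mono l hl]) hR
    · have := ((hlim.const_mul 2).const_mul R).sqrt
      simpa using this
  choose X hX using fun i j => cauchySeq_tendsto_of_complete (hcau i j)
  have hSX : Filter.Tendsto S Filter.atTop (nhds (X : Matrix m n ℝ)) :=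
    tendsto_pi_nhds.2 fun i => tendsto_pi_nhds.2 fun j => hX i j
  have hX0 : marginalError r c X = 0 :=
    tendsto_nhds_unique (((continuous_marginalError r c).tendsto X).comp hSX) herr
  have hcoup : IsCoupling r c X := by
    have n1 : 0 ≤ ∑ i, |∑ j, X i j - r i| := Finset.sum_nonneg fun _ _ => abs_nonneg _
    have n2 : 0 ≤ ∑ j, |∑ i, X i j - c j| := Finset.sum_nonneg fun _ _ => abs_nonneg _
    have hX0' : ∑ i, |∑ j, X i j - r i| + ∑ j, |∑ i, X i j - c j| = 0 := hX0
    have z1 := (Finset.sum_eq_zero_iff_of_nonneg fun i _ => abs_nonneg _).1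
      (show ∑ i, |∑ j, X i j - r i| = 0 by linarith)
    have z2 := (Finset.sum_eq_zero_iff_of_nonneg fun i _ => abs_nonneg _).1
      (show ∑ j, |∑ i, X i j - c j| = 0 by linarith)
    exact ⟨fun i j => ge_of_tendsto' (hX i j) fun k => (diagonalScaling_pos hX₀ _ _ i j).le,
      fun i => by simpa [sub_eq_zero] using z1 i (Finset.mem_univ i),
      fun j => by simpa [sub_eq_zero] using z2 j (Finset.mem_univ j)⟩
  refine ⟨X, hcoup, fun X' hX' => ?_, fun u' v' h' => ?_⟩
  -- The dual value of `S k` is at most the divergence of `X'`, and the divergence of `S k` exceeds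
  -- that dual value by at most `R / 2` times a vanishing error.
  · have h1 := ((continuous_kernelDivergence X₀).tendsto X).comp hSX
    have h2 : Filter.Tendsto (fun k => kernelDivergence X₀ X' + R / 2 * marginalError r c (S k))
        Filter.atTop (nhds (kernelDivergence X₀ X' + R / 2 * 0)) :=
      (herr.const_mul _).const_add _
    rw [mul_zero, add_zero] at h2
    refine le_of_tendsto_of_tendsto' h1 h2 fun k => ?_
    have a := (hb k).kernelDivergence_le hX₀ hr hc
    have b := (hb k).dual_le hX₀ hX' hr
    simp only [Function.comp, hS]
    linarith
  -- One scaling stays fixed while the other runs to the limit, so only the error of the fixed one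
  -- survives.
  · have hcont : Continuous fun Y : Matrix m n ℝ =>
        (∑ i, ∑ j, |diagonalScaling X₀ u' v' i j - Y i j|) ^ 2 := by
      have hc : ∀ i j, Continuous fun X : Matrix m n ℝ => X i j := fun i j =>
        (continuous_apply j).comp (continuous_apply i)
      fun_prop
    have h1 := (hcont.tendsto X).comp hSX
    have h2 : Filter.Tendsto (fun k => R * (marginalError r c (diagonalScaling X₀ u' v') +
        marginalError r c (S k))) Filter.atTop
        (nhds (R * (marginalError r c (diagonalScaling X₀ u' v') + 0))) :=
      (herr.const_add _).const_mul _
    rw [add_zero] at h2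
    exact le_of_tendsto_of_tendsto' h1 h2 fun k => h'.sq_l1_sub_le hX₀ (hb k)

end Scaling

/-! ### Sinkhorn iterations -/

section Sinkhorn

lemma diagonalScaling_transpose {m n : Type} (X₀ : Matrix m n ℝ) (u : m → ℝ) (v : n → ℝ)
    (i : m) (j : n) :
    diagonalScaling (fun j i => X₀ i j) v u j i = diagonalScaling X₀ u v i j := by
  simp only [diagonalScaling]; ring

variable {m n : Type} [Fintype m] [Fintype n]

/-- The dual objective, for scalings of mass one. -/
def dualValue (r : m → ℝ) (c : n → ℝ) (u : m → ℝ) (v : n → ℝ) : ℝ :=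
  ∑ i, r i * u i + ∑ j, c j * v j

/-- Positive probability vectors with entries at least `b`, and a positive kernel of mass one whose
entries have ratios at most `exp ρ`. -/
structure IsSinkhornData (X₀ : Matrix m n ℝ) (r : m → ℝ) (c : n → ℝ) (b ρ : ℝ) : Prop where
  kernel_pos : ∀ i j, 0 < X₀ i j
  kernel_mass : ∑ i, ∑ j, X₀ i j = 1
  kernel_ratio : ∀ i j i' j', X₀ i j ≤ Real.exp ρ * X₀ i' j'
  b_pos : 0 < b
  b_le_one : b ≤ 1
  ρ_nonneg : 0 ≤ ρ
  le_left : ∀ i, b ≤ r i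
  le_right : ∀ j, b ≤ c j
  sum_left : ∑ i, r i = 1
  sum_right : ∑ j, c j = 1

namespace IsSinkhornData

variable {X₀ : Matrix m n ℝ} {r : m → ℝ} {c : n → ℝ} {b ρ : ℝ}

lemma left_pos (h : IsSinkhornData X₀ r c b ρ) (i : m) : 0 < r i := h.b_pos.trans_le (h.le_left i)

lemma right_pos (h : IsSinkhornData X₀ r c b ρ) (j : n) : 0 < c j :=
  h.b_pos.trans_le (h.le_right j)

lemma nonempty_left (h : IsSinkhornData X₀ r c b ρ) : Nonempty m := by
  by_contra hm
  rw [not_nonempty_iff] at hm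
  simpa using h.sum_left

lemma nonempty_right (h : IsSinkhornData X₀ r c b ρ) : Nonempty n := by
  by_contra hm
  rw [not_nonempty_iff] at hm
  simpa using h.sum_right

lemma osc_nonneg (h : IsSinkhornData X₀ r c b ρ) : 0 ≤ ρ - Real.log b := by
  linarith [h.ρ_nonneg, Real.log_nonpos h.b_pos.le h.b_le_one]

/-- A column pass is a row pass of the transposed problem, so only row rescaling needs analysis. -/
lemma transpose (h : IsSinkhornData X₀ r c b ρ) : IsSinkhornData (fun j i => X₀ i j) c r b ρ where
  kernel_pos j i := h.kernel_pos i j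
  kernel_mass := by rw [Finset.sum_comm]; exact h.kernel_mass
  kernel_ratio j i j' i' := h.kernel_ratio i j i' j'
  b_pos := h.b_pos
  b_le_one := h.b_le_one
  ρ_nonneg := h.ρ_nonneg
  le_left := h.le_right
  le_right := h.le_left
  sum_left := h.sum_right
  sum_right := h.sum_left

end IsSinkhornData

lemma IsBalanced.transpose {X₀ : Matrix m n ℝ} {R : ℝ} {u : m → ℝ} {v : n → ℝ}
    (h : IsBalanced X₀ R u v) : IsBalanced (fun j i => X₀ i j) R v u where
  osc_left := h.osc_right
  osc_right := h.osc_left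
  mass := by
    simp only [diagonalScaling_transpose]
    rw [Finset.sum_comm]; exact h.mass

variable {X₀ : Matrix m n ℝ} {r : m → ℝ} {c : n → ℝ} {b ρ : ℝ}

/-- The dual variable after rescaling the rows to have sums `r`. -/
noncomputable def rescaleRows (X₀ : Matrix m n ℝ) (r : m → ℝ) (u : m → ℝ) (v : n → ℝ) : m → ℝ :=
  fun i => u i + Real.log (r i / ∑ j, diagonalScaling X₀ u v i j)

/-- The old `u` cancels: the new left variable is determined by `v` alone, and so the bound on its
oscillation does not deteriorate along the iteration. -/
lemma exp_rescaleRows (h : IsSinkhornData X₀ r c b ρ) (u : m → ℝ) (v : n → ℝ) (i : m) :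
    Real.exp (rescaleRows X₀ r u v i) = r i / ∑ j, X₀ i j * Real.exp (v j) := by
  have := h.nonempty_right
  have hs : 0 < ∑ j, X₀ i j * Real.exp (v j) :=
    Finset.sum_pos (fun j _ => mul_pos (h.kernel_pos i j) (Real.exp_pos _)) Finset.univ_nonempty
  have e : ∑ j, diagonalScaling X₀ u v i j = Real.exp (u i) * ∑ j, X₀ i j * Real.exp (v j) := by
    simp only [diagonalScaling, Finset.mul_sum, mul_assoc]
  have hr := h.left_pos i
  have hu := Real.exp_pos (u i)
  rw [rescaleRows, Real.exp_add, e, Real.exp_log (by positivity)]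
  field_simp

lemma row_sum_rescaleRows (h : IsSinkhornData X₀ r c b ρ) (u : m → ℝ) (v : n → ℝ) (i : m) :
    ∑ j, diagonalScaling X₀ (rescaleRows X₀ r u v) v i j = r i := by
  have := h.nonempty_right
  have hs : 0 < ∑ j, X₀ i j * Real.exp (v j) :=
    Finset.sum_pos (fun j _ => mul_pos (h.kernel_pos i j) (Real.exp_pos _)) Finset.univ_nonempty
  simp only [diagonalScaling, exp_rescaleRows h, mul_assoc, ← Finset.mul_sum]
  field_simp

/-- The new `exp (u i)` is a quotient whose numerators lie in `[b, 1]` and whose denominators have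
ratios at most `exp ρ`. The mass is one because the row sums are now `r`. -/
lemma IsBalanced.rescaleRows (h : IsSinkhornData X₀ r c b ρ) {u : m → ℝ} {v : n → ℝ}
    (hb : IsBalanced X₀ (ρ - Real.log b) u v) :
    IsBalanced X₀ (ρ - Real.log b) (rescaleRows X₀ r u v) v where
  osc_left i i' := by
    have := h.nonempty_right
    have hs : ∀ i, 0 < ∑ j, X₀ i j * Real.exp (v j) := fun i =>
      Finset.sum_pos (fun j _ => mul_pos (h.kernel_pos i j) (Real.exp_pos _)) Finset.univ_nonempty
    have hr1 : r i ≤ 1 := h.sum_left ▸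
      Finset.single_le_sum (fun i _ => (h.left_pos i).le) (Finset.mem_univ i)
    have h1 : ∑ j, X₀ i' j * Real.exp (v j) ≤ Real.exp ρ * ∑ j, X₀ i j * Real.exp (v j) := by
      rw [Finset.mul_sum]
      refine Finset.sum_le_sum fun j _ => ?_
      rw [← mul_assoc]
      exact mul_le_mul_of_nonneg_right (h.kernel_ratio _ _ _ _) (Real.exp_pos _).le
    rw [sub_le_iff_le_add, ← Real.exp_le_exp, Real.exp_add, Real.exp_sub, Real.exp_log h.b_pos,
      exp_rescaleRows h, exp_rescaleRows h]
    have hi := hs i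
    have hi' := hs i'
    have hbp := h.b_pos
    calc r i / ∑ j, X₀ i j * Real.exp (v j) ≤ 1 / ∑ j, X₀ i j * Real.exp (v j) := by gcongr
      _ ≤ Real.exp ρ / ∑ j, X₀ i' j * Real.exp (v j) := by
        rw [div_le_div_iff₀ hi hi', one_mul]; exact h1
      _ = Real.exp ρ / b * (b / ∑ j, X₀ i' j * Real.exp (v j)) := by field_simp
      _ ≤ _ := by gcongr; exact h.le_left i'
  osc_right := hb.osc_right
  mass := by simp only [row_sum_rescaleRows h, h.sum_left]

/-- The gain is exactly the Kullback–Leibler divergence of `r` from the current row sums, to which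
the weak Pinsker inequality applies. -/
lemma dualValue_rescaleRows (h : IsSinkhornData X₀ r c b ρ) {u : m → ℝ} {v : n → ℝ} {R : ℝ}
    (hb : IsBalanced X₀ R u v) :
    dualValue r c u v + (∑ i, |∑ j, diagonalScaling X₀ u v i j - r i|) ^ 2 / 4 ≤
      dualValue r c (rescaleRows X₀ r u v) v := by
  have := h.nonempty_right
  have hs : ∀ i, 0 < ∑ j, diagonalScaling X₀ u v i j := fun i =>
    Finset.sum_pos (fun j _ => diagonalScaling_pos h.kernel_pos u v i j) Finset.univ_nonempty
  have key := sq_sum_abs_sub_le_kl h.left_pos hs h.sum_left hb.mass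
  simp only [abs_sub_comm (r _)] at key
  have e : ∑ i, r i * rescaleRows X₀ r u v i = ∑ i, r i * u i +
      ∑ i, r i * (Real.log (r i) - Real.log (∑ j, diagonalScaling X₀ u v i j)) := by
    rw [← Finset.sum_add_distrib]
    refine Finset.sum_congr rfl fun i _ => ?_
    rw [rescaleRows, Real.log_div (h.left_pos i).ne' (hs i).ne']; ring
  rw [dualValue, dualValue, e]
  linarith

lemma dualValue_swap (u : m → ℝ) (v : n → ℝ) : dualValue c r v u = dualValue r c u v :=
  add_comm _ _

/-- The invariant of the loop of Sinkhorn's algorithm. -/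
structure SinkhornInvariant (X₀ : Matrix m n ℝ) (r : m → ℝ) (c : n → ℝ) (R : ℝ) (k : ℕ)
    (st : SinkhornState m n) : Prop where
  count : st.k = k
  eq_scaling : st.X = diagonalScaling X₀ st.u st.v
  balanced : IsBalanced X₀ R st.u st.v
  row : k % 2 = 1 → ∀ i, ∑ j, st.X i j = r i
  col : k ≠ 0 → k % 2 = 0 → ∀ j, ∑ i, st.X i j = c j

lemma sinkhornStep_val_odd {st : SinkhornState m n} (h : (st.k + 1) % 2 = 1)
    (hX : st.X = diagonalScaling X₀ st.u st.v) :
    (sinkhornStep X₀ r c st).val = ⟨st.k + 1, rescaleRows X₀ r st.u st.v, st.v,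
      diagonalScaling X₀ (rescaleRows X₀ r st.u st.v) st.v⟩ := by
  have : rescaleRows X₀ r st.u st.v = fun i => st.u i + Real.log (r i / ∑ j, st.X i j) := by
    rw [hX]; rfl
  simp only [sinkhornStep, if_pos h, this]
  rfl

lemma sinkhornStep_val_even {st : SinkhornState m n} (h : ¬(st.k + 1) % 2 = 1)
    (hX : st.X = diagonalScaling X₀ st.u st.v) :
    (sinkhornStep X₀ r c st).val =
      ⟨st.k + 1, st.u, rescaleRows (fun j i => X₀ i j) c st.v st.u,
        diagonalScaling X₀ st.u (rescaleRows (fun j i => X₀ i j) c st.v st.u)⟩ := by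
  have : rescaleRows (fun j i => X₀ i j) c st.v st.u =
      fun j => st.v j + Real.log (c j / ∑ i, st.X i j) := by
    funext j
    simp only [rescaleRows, hX, diagonalScaling_transpose]
  simp only [sinkhornStep, if_neg h, this]
  rfl

lemma SinkhornInvariant.step (h : IsSinkhornData X₀ r c b ρ) {k : ℕ} {st : SinkhornState m n}
    (hi : SinkhornInvariant X₀ r c (ρ - Real.log b) k st) :
    SinkhornInvariant X₀ r c (ρ - Real.log b) (k + 1) (sinkhornStep X₀ r c st).val := by
  have hk := hi.count
  by_cases hp : (st.k + 1) % 2 = 1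
  · rw [sinkhornStep_val_odd hp hi.eq_scaling]
    exact ⟨by simp [hk], rfl, hi.balanced.rescaleRows h, fun _ i => row_sum_rescaleRows h _ _ i,
      fun _ _ => by omega⟩
  · rw [sinkhornStep_val_even hp hi.eq_scaling]
    refine ⟨by simp [hk], rfl, (hi.balanced.transpose.rescaleRows h.transpose).transpose,
      fun _ => by omega, fun _ _ j => ?_⟩
    have := row_sum_rescaleRows h.transpose st.v st.u j
    simpa only [diagonalScaling_transpose] using this

/-- Once a pass has been made, the side just rescaled is exact, so the whole marginal error sits on
the side about to be rescaled and enters the gain. Initially neither side need be exact, and only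
monotonicity is claimed. -/
lemma SinkhornInvariant.dualValue_mono (h : IsSinkhornData X₀ r c b ρ) {k : ℕ}
    {st : SinkhornState m n} (hi : SinkhornInvariant X₀ r c (ρ - Real.log b) k st) :
    dualValue r c st.u st.v + (if k = 0 then 0 else marginalError r c st.X ^ 2 / 4) ≤
      dualValue r c (sinkhornStep X₀ r c st).val.u (sinkhornStep X₀ r c st).val.v := by
  have hk := hi.count
  by_cases hp : (st.k + 1) % 2 = 1
  · rw [sinkhornStep_val_odd hp hi.eq_scaling]
    refine le_trans (add_le_add_right ?_ _) (dualValue_rescaleRows h hi.balanced)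
    split_ifs with h0
    · positivity
    · have : ∑ j, |∑ i, st.X i j - c j| = 0 :=
        Finset.sum_eq_zero fun j _ => by rw [hi.col h0 (by omega) j, sub_self, abs_zero]
      rw [marginalError, this, add_zero, hi.eq_scaling]
  · rw [sinkhornStep_val_even hp hi.eq_scaling]
    have := dualValue_rescaleRows h.transpose hi.balanced.transpose
    rw [dualValue_swap (r := r) (c := c), dualValue_swap (r := r) (c := c)] at this
    refine le_trans (add_le_add_right ?_ _) this
    split_ifs with h0
    · positivity
    · have : ∑ i, |∑ j, st.X i j - r i| = 0 :=
        Finset.sum_eq_zero fun i _ => by rw [hi.row (by omega) i, sub_self, abs_zero]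
      rw [marginalError, this, zero_add, hi.eq_scaling]
      simp only [diagonalScaling_transpose, le_refl]

/-- The iterates of the loop of Sinkhorn's algorithm. -/
noncomputable def sinkhornIter (X₀ : Matrix m n ℝ) (r : m → ℝ) (c : n → ℝ) (k : ℕ) :
    SinkhornState m n :=
  (fun st => (sinkhornStep X₀ r c st).val)^[k] ⟨0, fun _ => 0, fun _ => 0, X₀⟩

lemma sinkhornIter_succ (X₀ : Matrix m n ℝ) (r : m → ℝ) (c : n → ℝ) (k : ℕ) :
    sinkhornIter X₀ r c (k + 1) = (sinkhornStep X₀ r c (sinkhornIter X₀ r c k)).val :=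
  Function.iterate_succ_apply' _ _ _

lemma sinkhornInvariant_iter (h : IsSinkhornData X₀ r c b ρ) (k : ℕ) :
    SinkhornInvariant X₀ r c (ρ - Real.log b) k (sinkhornIter X₀ r c k) := by
  induction k with
  | zero =>
    have e : (diagonalScaling X₀ (fun _ => 0) (fun _ => 0)) = X₀ := by
      funext i j; simp [diagonalScaling]
    refine ⟨rfl, e.symm, ⟨fun _ _ => ?_, fun _ _ => ?_, ?_⟩, fun h => by omega, fun h => by omega⟩
    · simpa [sinkhornIter] using h.osc_nonneg
    · simpa [sinkhornIter] using h.osc_nonneg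
    · simpa [sinkhornIter, e] using h.kernel_mass
  | succ k ih => rw [sinkhornIter_succ]; exact ih.step h

/-- The dual value starts at `0`; the first pass is not counted, so `k + 1` passes yield `k` gains.
-/
lemma mul_le_dualValue_iter (h : IsSinkhornData X₀ r c b ρ) {ε' : ℝ} (hε : 0 ≤ ε') (k : ℕ)
    (hk : ∀ l < k + 1, ε' < marginalError r c (sinkhornIter X₀ r c l).X) :
    (k : ℝ) * (ε' ^ 2 / 4) ≤
      dualValue r c (sinkhornIter X₀ r c (k + 1)).u (sinkhornIter X₀ r c (k + 1)).v := by
  induction k with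
  | zero =>
    have := (sinkhornInvariant_iter h 0).dualValue_mono h
    rw [← sinkhornIter_succ] at this
    refine le_trans ?_ this
    simp [sinkhornIter, dualValue]
  | succ k ih =>
    have h1 := ih fun l hl => hk l (by omega)
    have h2 := (sinkhornInvariant_iter h (k + 1)).dualValue_mono h
    rw [← sinkhornIter_succ, if_neg (by omega)] at h2
    have h3 := pow_le_pow_left₀ hε (hk (k + 1) (by omega)).le 2
    push_cast
    linarith

lemma IsCoupling.outer (hr : ∀ i, 0 ≤ r i) (hc : ∀ j, 0 ≤ c j) (hr1 : ∑ i, r i = 1)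
    (hc1 : ∑ j, c j = 1) : IsCoupling r c fun i j => r i * c j where
  nonneg i j := mul_nonneg (hr i) (hc j)
  row i := by rw [← Finset.mul_sum, hc1, mul_one]
  col j := by rw [← Finset.sum_mul, hr1, one_mul]

/-- Weak duality against the product coupling, whose entries have nonpositive logarithms. -/
lemma dualValue_le (h : IsSinkhornData X₀ r c b ρ) {B R : ℝ} (hB : ∀ i j, -Real.log (X₀ i j) ≤ B)
    {u : m → ℝ} {v : n → ℝ} (hb : IsBalanced X₀ R u v) : dualValue r c u v ≤ B := by
  have hcp := IsCoupling.outer (fun i => (h.left_pos i).le) (fun j => (h.right_pos j).le)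
    h.sum_left h.sum_right
  refine (hb.dual_le h.kernel_pos hcp h.sum_left).trans ?_
  have hX := hcp.sum_eq h.sum_left
  have hle : ∀ i j, r i * c j ≤ 1 := fun i j => hX ▸
    (Finset.single_le_sum (f := fun j => r i * c j) (fun _ _ => hcp.nonneg _ _)
      (Finset.mem_univ j)).trans (Finset.single_le_sum (f := fun i => ∑ j, r i * c j)
        (fun _ _ => Finset.sum_nonneg fun _ _ => hcp.nonneg _ _) (Finset.mem_univ i))
  calc _ ≤ ∑ i, ∑ j, r i * c j * B := Finset.sum_le_sum fun i _ => Finset.sum_le_sum fun j _ => by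
        refine mul_le_mul_of_nonneg_left ?_ (hcp.nonneg i j)
        linarith [hB i j, Real.log_nonpos (hcp.nonneg i j) (hle i j)]
    _ = (∑ i, ∑ j, r i * c j) * B := by simp only [Finset.sum_mul]
    _ = B := by rw [hX, one_mul]

/-- The iteration bound. -/
lemma le_of_forall_lt_marginalError (h : IsSinkhornData X₀ r c b ρ) {B ε' : ℝ} (hε : 0 < ε')
    (hB : ∀ i j, -Real.log (X₀ i j) ≤ B) {N : ℕ}
    (hN : ∀ l < N, ε' < marginalError r c (sinkhornIter X₀ r c l).X) :
    (N : ℝ) ≤ 1 + 4 * B / ε' ^ 2 := by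
  -- The initial dual value is `0`, and `B` bounds it.
  have hB0 : 0 ≤ B := by
    have := dualValue_le h hB (sinkhornInvariant_iter h 0).balanced
    simpa [dualValue, sinkhornIter] using this
  rcases N with _ | k
  · simp; positivity
  · have h1 := mul_le_dualValue_iter h hε.le k hN
    have h2 := dualValue_le h hB (sinkhornInvariant_iter h (k + 1)).balanced
    have h3 : (k : ℝ) ≤ 4 * B / ε' ^ 2 := by
      rw [le_div_iff₀ (by positivity)]; linarith
    push_cast
    linarith

/-- Otherwise the iteration bound would hold for every `N`; any finite `B` serves here. -/
lemma exists_marginalError_le (h : IsSinkhornData X₀ r c b ρ) {ε' : ℝ} (hε : 0 < ε') :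
    ∃ k, marginalError r c (sinkhornIter X₀ r c k).X ≤ ε' := by
  by_contra! hc
  obtain ⟨B, hB⟩ : ∃ B, ∀ i j, -Real.log (X₀ i j) ≤ B := by
    refine ⟨∑ i, ∑ j, |-Real.log (X₀ i j)|, fun i j => (le_abs_self _).trans ?_⟩
    exact (Finset.single_le_sum (f := fun j => |-Real.log (X₀ i j)|)
      (fun _ _ => abs_nonneg _) (Finset.mem_univ j)).trans
      (Finset.single_le_sum (f := fun i => ∑ j, |-Real.log (X₀ i j)|)
        (fun _ _ => Finset.sum_nonneg fun _ _ => abs_nonneg _) (Finset.mem_univ i))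
  obtain ⟨N, hN⟩ := exists_nat_gt (1 + 4 * B / ε' ^ 2)
  exact absurd (le_of_forall_lt_marginalError h hε hB (N := N) fun l _ => hc l) (not_le.2 hN)

/-- There is an optimal coupling, and the iterates of Sinkhorn's algorithm are close to it. -/
lemma exists_optimal_near_iter (h : IsSinkhornData X₀ r c b ρ) :
    ∃ X, IsCoupling r c X ∧
      (∀ X', IsCoupling r c X' → kernelDivergence X₀ X ≤ kernelDivergence X₀ X') ∧
      ∀ k, (∑ i, ∑ j, |(sinkhornIter X₀ r c k).X i j - X i j|) ^ 2 ≤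
        (ρ - Real.log b) * marginalError r c (sinkhornIter X₀ r c k).X := by
  have := h.nonempty_left
  have := h.nonempty_right
  obtain ⟨X, h1, h2, h3⟩ := exists_optimal_coupling (R := ρ - Real.log b) h.kernel_pos h.sum_left
    h.sum_right fun δ hδ => by
      obtain ⟨k, hk⟩ := exists_marginalError_le h hδ
      have hi := sinkhornInvariant_iter h k
      exact ⟨_, _, hi.balanced, by rwa [← hi.eq_scaling]⟩
  refine ⟨X, h1, h2, fun k => ?_⟩
  have hi := sinkhornInvariant_iter h k
  have := h3 _ _ hi.balanced
  rwa [← hi.eq_scaling] at this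

end Sinkhorn

/-! ### Rounding to a coupling -/

section Rounding

variable {m n : Type} [Fintype m] [Fintype n]

/-- Both scalings only decrease entries and cap the marginals, so the residuals `a`, `d` are
nonnegative, with common total `e`, and the rank-one term fills them exactly. The ℓ¹ change is at
most the mass `e` removed plus the mass `e` restored. Each scaling removes at most half of the
corresponding marginal error. -/
lemma roundCoupling_spec [Nonempty m] [Nonempty n] {F : Matrix m n ℝ} {r : m → ℝ} {c : n → ℝ}
    (hF : ∀ i j, 0 < F i j)
    (hF1 : ∑ i, ∑ j, F i j = 1) (hr : ∀ i, 0 < r i) (hc : ∀ j, 0 < c j) (hr1 : ∑ i, r i = 1)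
    (hc1 : ∑ j, c j = 1) :
    IsCoupling r c (roundCoupling F r c).val ∧ (∀ i j, 0 < (roundCoupling F r c).val i j) ∧
      ∑ i, ∑ j, |(roundCoupling F r c).val i j - F i j| ≤ marginalError r c F := by
  obtain ⟨r', hr'⟩ : ∃ r' : m → ℝ, ∀ i, r' i = ∑ j, F i j := ⟨_, fun _ => rfl⟩
  obtain ⟨x, hx⟩ : ∃ x : m → ℝ, ∀ i, x i = min (r i / r' i) 1 := ⟨_, fun _ => rfl⟩
  obtain ⟨F', hF'⟩ : ∃ F' : m → n → ℝ, ∀ i j, F' i j = x i * F i j := ⟨_, fun _ _ => rfl⟩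
  obtain ⟨c', hc'⟩ : ∃ c' : n → ℝ, ∀ j, c' j = ∑ i, F' i j := ⟨_, fun _ => rfl⟩
  obtain ⟨y, hy⟩ : ∃ y : n → ℝ, ∀ j, y j = min (c j / c' j) 1 := ⟨_, fun _ => rfl⟩
  obtain ⟨F₂, hF₂⟩ : ∃ F₂ : m → n → ℝ, ∀ i j, F₂ i j = F' i j * y j := ⟨_, fun _ _ => rfl⟩
  obtain ⟨a, ha⟩ : ∃ a : m → ℝ, ∀ i, a i = r i - ∑ j, F₂ i j := ⟨_, fun _ => rfl⟩
  obtain ⟨d, hd⟩ : ∃ d : n → ℝ, ∀ j, d j = c j - ∑ i, F₂ i j := ⟨_, fun _ => rfl⟩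
  obtain ⟨e, he⟩ : ∃ e : ℝ, e = ∑ i, |a i| := ⟨_, rfl⟩
  have hG : ∀ i j, (roundCoupling F r c).val i j = F₂ i j + a i * d j / e := by
    have e1 : r' = fun i => ∑ j, F i j := funext hr'
    subst e1
    have e2 : x = _ := funext hx
    subst e2
    have e3 : F' = _ := funext₂ hF'
    subst e3
    have e4 : c' = _ := funext hc'
    subst e4
    have e5 : y = _ := funext hy
    subst e5
    have e6 : F₂ = _ := funext₂ hF₂
    subst e6
    have e7 : a = _ := funext ha
    subst e7
    have e8 : d = _ := funext hd
    subst e8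
    subst he
    intro i j
    rfl
  have r'pos : ∀ i, 0 < r' i := fun i => by
    rw [hr']; exact Finset.sum_pos (fun j _ => hF i j) Finset.univ_nonempty
  have xpos : ∀ i, 0 < x i := fun i => by
    rw [hx]; exact lt_min (div_pos (hr i) (r'pos i)) one_pos
  have xle : ∀ i, x i ≤ 1 := fun i => by rw [hx]; exact min_le_right _ _
  have F'pos : ∀ i j, 0 < F' i j := fun i j => by rw [hF']; exact mul_pos (xpos i) (hF i j)
  have F'le : ∀ i j, F' i j ≤ F i j := fun i j => by
    rw [hF']; exact mul_le_of_le_one_left (hF i j).le (xle i)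
  have c'pos : ∀ j, 0 < c' j := fun j => by
    rw [hc']; exact Finset.sum_pos (fun i _ => F'pos i j) Finset.univ_nonempty
  have ypos : ∀ j, 0 < y j := fun j => by
    rw [hy]; exact lt_min (div_pos (hc j) (c'pos j)) one_pos
  have yle : ∀ j, y j ≤ 1 := fun j => by rw [hy]; exact min_le_right _ _
  have F₂pos : ∀ i j, 0 < F₂ i j := fun i j => by rw [hF₂]; exact mul_pos (F'pos i j) (ypos j)
  have F₂le : ∀ i j, F₂ i j ≤ F' i j := fun i j => by
    rw [hF₂]; exact mul_le_of_le_one_right (F'pos i j).le (yle j)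
  have row' : ∀ i, ∑ j, F' i j = min (r i) (r' i) := fun i => by
    simp only [hF', ← Finset.mul_sum, ← hr']
    rw [hx, min_mul_of_nonneg _ _ (r'pos i).le, div_mul_cancel₀ _ (r'pos i).ne', one_mul]
  have col₂ : ∀ j, ∑ i, F₂ i j = min (c j) (c' j) := fun j => by
    simp only [hF₂, ← Finset.sum_mul, ← hc']
    rw [mul_comm, hy, min_mul_of_nonneg _ _ (c'pos j).le, div_mul_cancel₀ _ (c'pos j).ne', one_mul]
  have a0 : ∀ i, 0 ≤ a i := fun i => by
    rw [ha, sub_nonneg]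
    exact (Finset.sum_le_sum fun j _ => F₂le i j).trans (row' i ▸ min_le_left _ _)
  have d0 : ∀ j, 0 ≤ d j := fun j => by
    rw [hd, sub_nonneg, col₂]; exact min_le_left _ _
  have he' : e = ∑ i, a i := by
    rw [he]; exact Finset.sum_congr rfl fun i _ => abs_of_nonneg (a0 i)
  have hea : e = 1 - ∑ i, ∑ j, F₂ i j := by
    rw [he']; simp only [ha, Finset.sum_sub_distrib, hr1]
  have hed : e = ∑ j, d j := by
    simp only [hd, Finset.sum_sub_distrib, hc1]; rw [hea, Finset.sum_comm]
  have e0 : 0 ≤ e := by rw [he']; exact Finset.sum_nonneg fun i _ => a0 i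
  -- If `e = 0` all residuals vanish, which is why the convention `0 / 0 = 0` is harmless.
  have ae : ∀ i, a i * e / e = a i := fun i => by
    rcases eq_or_ne e 0 with h | h
    · have := (Finset.sum_eq_zero_iff_of_nonneg fun i _ => a0 i).1 (he' ▸ h) i (Finset.mem_univ i)
      simp [this]
    · field_simp
  have de : ∀ j, e * d j / e = d j := fun j => by
    rcases eq_or_ne e 0 with h | h
    · have := (Finset.sum_eq_zero_iff_of_nonneg fun j _ => d0 j).1 (hed ▸ h) j (Finset.mem_univ j)
      simp [this]
    · field_simp
  have q0 : ∀ i j, 0 ≤ a i * d j / e := fun i j => div_nonneg (mul_nonneg (a0 i) (d0 j)) e0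
  have rowq : ∀ i, ∑ j, a i * d j / e = a i := fun i => by
    rw [← Finset.sum_div, ← Finset.mul_sum, ← hed, ae]
  have colq : ∀ j, ∑ i, a i * d j / e = d j := fun j => by
    rw [← Finset.sum_div, ← Finset.sum_mul, ← he', de]
  have Gpos : ∀ i j, 0 < (roundCoupling F r c).val i j := fun i j => by
    rw [hG]; exact add_pos_of_pos_of_nonneg (F₂pos i j) (q0 i j)
  refine ⟨⟨fun i j => (Gpos i j).le, fun i => ?_, fun j => ?_⟩, Gpos, ?_⟩
  · rw [Finset.sum_congr rfl fun j _ => hG i j, Finset.sum_add_distrib, rowq, ha]; ring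
  · rw [Finset.sum_congr rfl fun i _ => hG i j, Finset.sum_add_distrib, colq, hd]; ring
  have h1 : ∑ i, ∑ j, |(roundCoupling F r c).val i j - F i j| ≤
      ∑ i, ∑ j, (a i * d j / e + (F i j - F₂ i j)) := by
    refine Finset.sum_le_sum fun i _ => Finset.sum_le_sum fun j _ => ?_
    rw [hG, abs_le]
    have := (F₂le i j).trans (F'le i j)
    constructor <;> linarith [q0 i j]
  have h2 : ∑ i, ∑ j, (a i * d j / e + (F i j - F₂ i j)) = 2 * e := by
    simp only [Finset.sum_add_distrib, Finset.sum_sub_distrib, rowq, hF1, ← he']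
    linarith
  have h3 : ∑ i, (r' i - min (r i) (r' i)) = (∑ i, |∑ j, F i j - r i|) / 2 := by
    rw [← sum_posPart_of_sum_eq_zero (by rw [Finset.sum_sub_distrib, hF1, hr1, sub_self])]
    refine Finset.sum_congr rfl fun i _ => ?_
    rw [← hr', ← max_sub_sub_left, sub_self]
  -- Row scaling has only lowered the column sums, so their excess over `c` is at most the excess
  -- for `F` itself.
  have h4 : ∑ j, (c' j - min (c j) (c' j)) ≤ (∑ j, |∑ i, F i j - c j|) / 2 := by
    rw [← sum_posPart_of_sum_eq_zero (by
      rw [Finset.sum_sub_distrib, hc1, Finset.sum_comm, hF1, sub_self])]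
    refine Finset.sum_le_sum fun j _ => ?_
    rw [← max_sub_sub_left, sub_self]
    have : c' j ≤ ∑ i, F i j := by rw [hc']; exact Finset.sum_le_sum fun i _ => F'le i j
    gcongr
  have h5 : ∑ i, r' i = 1 := by simp only [hr', hF1]
  have h6 : ∑ j, c' j = ∑ i, min (r i) (r' i) := by
    simp only [hc', ← row']; exact Finset.sum_comm
  have h7 : ∑ i, ∑ j, F₂ i j = ∑ j, min (c j) (c' j) := by
    simp only [← col₂]; exact Finset.sum_comm
  rw [Finset.sum_sub_distrib] at h3 h4
  rw [marginalError]
  linarith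

end Rounding

/-! ### Running times -/

namespace Timed

@[simp] lemma pure_time {α : Type} (a : α) : (pure a : Timed α).time = 0 := rfl
@[simp] lemma bind_time {α β : Type} (x : Timed α) (f : α → Timed β) :
    (x >>= f).time = x.time + (f x.val).time := rfl
@[simp] lemma tick_time : tick.time = 1 := rfl
@[simp] lemma add_time (x y : ℝ) : (add x y).time = 1 := rfl
@[simp] lemma sub_time (x y : ℝ) : (sub x y).time = 1 := rfl
@[simp] lemma mul_time (x y : ℝ) : (mul x y).time = 1 := rfl
@[simp] lemma div_time (x y : ℝ) : (div x y).time = 1 := rfl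
@[simp] lemma abs_time (x : ℝ) : (abs x).time = 1 := rfl
@[simp] lemma exp_time (x : ℝ) : (exp x).time = 1 := rfl
@[simp] lemma log_time (x : ℝ) : (log x).time = 1 := rfl
@[simp] lemma lt_time (x y : ℝ) : (lt x y).time = 1 := rfl
@[simp] lemma tabulate_time {ι α : Type} [Fintype ι] (f : ι → Timed α) :
    (tabulate f).time = ∑ i, ((f i).time + 1) := rfl
@[simp] lemma sumOver_time {ι : Type} [Fintype ι] (f : ι → Timed ℝ) :
    (sumOver f).time = ∑ i, ((f i).time + 1) := rfl

lemma whileLoop_spec {σ : Type} {guard : σ → Timed Bool} {body : σ → Timed σ} {s : σ}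
    (h : ∃ k, (guard ((fun s' => (body s').val)^[k] s)).val = false) :
    ∃ T, (∀ l < T, (guard ((fun s' => (body s').val)^[l] s)).val = true) ∧
      (guard ((fun s' => (body s').val)^[T] s)).val = false ∧
      (whileLoop guard body s).val = (fun s' => (body s').val)^[T] s ∧
      (whileLoop guard body s).time =
        ∑ k ∈ Finset.range (T + 1), (guard ((fun s' => (body s').val)^[k] s)).time +
          ∑ k ∈ Finset.range T, (body ((fun s' => (body s').val)^[k] s)).time := by
  classical
  refine ⟨Nat.find h, fun l hl => by simpa using Nat.find_min h hl, Nat.find_spec h, ?_, ?_⟩ <;>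
  · rw [whileLoop, dif_pos h]

end Timed

section Times

variable {m n : Type} [Fintype m] [Fintype n] {D : ℕ}

/-- `D` bounds the sizes of the tables indexed by `m`, `n` and `m × n`. -/
structure IsSizeBound (m n : Type) [Fintype m] [Fintype n] (D : ℕ) : Prop where
  one_le : 1 ≤ D
  left : Fintype.card m ≤ D
  right : Fintype.card n ≤ D
  mul : Fintype.card m * Fintype.card n ≤ D

lemma rowSums_time (X : Matrix m n ℝ) :
    (rowSums X).time = Fintype.card m * (Fintype.card n + 1) := by
  simp [rowSums]; ring

lemma colSums_time (X : Matrix m n ℝ) :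
    (colSums X).time = Fintype.card n * (Fintype.card m + 1) := by
  simp [colSums]; ring

lemma l1Dist_time (u v : m → ℝ) : (l1Dist u v).time = Fintype.card m * (1 + 1 + 1) := by
  simp [l1Dist]; ring

lemma diagScale_time (x : m → ℝ) (A : Matrix m n ℝ) (y : n → ℝ) :
    (diagScale x A y).time = Fintype.card m * (Fintype.card n * (1 + 1 + 1) + 1) := by
  simp [diagScale]; ring

lemma sinkhornGuard_time_le (hD : IsSizeBound m n D) (r : m → ℝ) (c : n → ℝ) (ε' : ℝ)
    (st : SinkhornState m n) : (sinkhornGuard r c ε' st).time ≤ ((20 * D : ℕ) : ℕ∞) := by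
  simp only [sinkhornGuard, Timed.bind_time, rowSums_time, colSums_time, l1Dist_time,
    Timed.add_time, Timed.lt_time]
  have := hD.one_le; have := hD.left; have := hD.right; have := hD.mul
  have h : Fintype.card m * (Fintype.card n + 1) + (Fintype.card m * (1 + 1 + 1) +
    (Fintype.card n * (Fintype.card m + 1) + (Fintype.card n * (1 + 1 + 1) + (1 + 1)))) ≤ 20 * D := by
    nlinarith
  exact_mod_cast h

lemma sinkhornStep_time_le (hD : IsSizeBound m n D) (X₀ : Matrix m n ℝ) (r : m → ℝ) (c : n → ℝ)
    (st : SinkhornState m n) : (sinkhornStep X₀ r c st).time ≤ ((30 * D : ℕ) : ℕ∞) := by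
  have := hD.one_le; have := hD.left; have := hD.right; have := hD.mul
  set a := Fintype.card m with ha
  set b := Fintype.card n with hb
  by_cases hp : (st.k + 1) % 2 = 1
  · simp only [sinkhornStep, if_pos hp, Timed.bind_time, rowSums_time, diagScale_time,
      Timed.tabulate_time, Timed.tick_time, Timed.add_time, Timed.div_time, Timed.log_time,
      Timed.exp_time, Timed.pure_time, Finset.sum_const, Finset.card_univ, nsmul_eq_mul, ← ha, ← hb]
    norm_cast
    nlinarith
  · simp only [sinkhornStep, if_neg hp, Timed.bind_time, colSums_time, diagScale_time,
      Timed.tabulate_time, Timed.tick_time, Timed.add_time, Timed.div_time, Timed.log_time,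
      Timed.exp_time, Timed.pure_time, Finset.sum_const, Finset.card_univ, nsmul_eq_mul, ← ha, ← hb]
    norm_cast
    nlinarith

lemma roundCoupling_time_le (hD : IsSizeBound m n D) (F : Matrix m n ℝ) (r : m → ℝ) (c : n → ℝ) :
    (roundCoupling F r c).time ≤ ((50 * D : ℕ) : ℕ∞) := by
  have := hD.one_le; have := hD.left; have := hD.right; have := hD.mul
  set a := Fintype.card m with ha
  set b := Fintype.card n with hb
  have e : (roundCoupling F r c).time = ∑ _i : m, (∑ _j : n, ((0 : ℕ∞) + 1) + 1) +
      (∑ _i : m, (1 + 1 + 1) + (∑ _i : m, (∑ _j : n, (1 + 1) + 1) +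
      (∑ _j : n, (∑ _i : m, (0 + 1) + 1) + (∑ _j : n, (1 + 1 + 1) +
      (∑ _i : m, (∑ _j : n, (1 + 1) + 1) + (∑ _i : m, (∑ _j : n, (0 + 1) + 1) +
      (∑ _j : n, (∑ _i : m, (0 + 1) + 1) + (∑ _i : m, (1 + 1) + (∑ _j : n, (1 + 1) +
      (∑ _i : m, (1 + 1) + ∑ _i : m, (∑ _j : n, (1 + (1 + 1) + 1) + 1))))))))))) := rfl
  rw [e]
  simp only [Finset.sum_const, Finset.card_univ, nsmul_eq_mul, ← ha, ← hb]
  norm_cast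
  nlinarith

lemma sinkhornGuard_val (r : m → ℝ) (c : n → ℝ) (ε' : ℝ) (st : SinkhornState m n) :
    (sinkhornGuard r c ε' st).val = decide (ε' < marginalError r c st.X) := rfl

/-- What Sinkhorn's algorithm returns, and its running time, if it terminates. -/
lemma sinkhorn_spec (hD : IsSizeBound m n D) {K X₀ : Matrix m n ℝ} {r : m → ℝ} {c : n → ℝ} {ε' : ℝ}
    (hX₀ : X₀ = fun i j => K i j / ∑ i, ∑ j, |K i j|)
    (h : ∃ k, marginalError r c (sinkhornIter X₀ r c k).X ≤ ε') :
    ∃ T : ℕ, (∀ l < T, ε' < marginalError r c (sinkhornIter X₀ r c l).X) ∧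
      marginalError r c (sinkhornIter X₀ r c T).X ≤ ε' ∧
      (sinkhorn K r c ε').val = (sinkhornIter X₀ r c T).X ∧
      (sinkhorn K r c ε').time ≤ ((60 * D * (T + 1) : ℕ) : ℕ∞) := by
  obtain ⟨k, hk⟩ := h
  obtain ⟨T, h1, h2, h3, h4⟩ := Timed.whileLoop_spec (guard := sinkhornGuard r c ε')
    (body := sinkhornStep X₀ r c) (s := ⟨0, fun _ => 0, fun _ => 0, X₀⟩)
    ⟨k, by rw [sinkhornGuard_val]; exact decide_eq_false (not_lt.2 hk)⟩
  refine ⟨T, fun l hl => ?_, ?_, ?_, ?_⟩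
  · have := h1 l hl
    rw [sinkhornGuard_val] at this
    exact of_decide_eq_true this
  · rw [sinkhornGuard_val] at h2
    exact not_lt.1 (of_decide_eq_false h2)
  · subst hX₀
    exact congrArg SinkhornState.X h3
  · have e : (sinkhorn K r c ε').time = ∑ _i : m, (∑ _j : n, ((1 : ℕ∞) + 1) + 1) +
        (∑ _i : m, (∑ _j : n, ((1 : ℕ∞) + 1) + 1) + (∑ _i : m, (0 + 1) + (∑ _j : n, (0 + 1) +
          ((Timed.whileLoop (sinkhornGuard r c ε') (sinkhornStep X₀ r c)
            ⟨0, fun _ => 0, fun _ => 0, X₀⟩).time + 0)))) := by subst hX₀; rfl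
    have g1 : ∑ k ∈ Finset.range (T + 1), (sinkhornGuard r c ε'
        ((fun s' => (sinkhornStep X₀ r c s').val)^[k] ⟨0, fun _ => 0, fun _ => 0, X₀⟩)).time ≤
        (((T + 1) * (20 * D) : ℕ) : ℕ∞) := by
      refine (Finset.sum_le_card_nsmul _ _ _ fun k _ => sinkhornGuard_time_le hD r c ε' _).trans ?_
      simp
    have g2 : ∑ k ∈ Finset.range T, (sinkhornStep X₀ r c
        ((fun s' => (sinkhornStep X₀ r c s').val)^[k] ⟨0, fun _ => 0, fun _ => 0, X₀⟩)).time ≤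
        ((T * (30 * D) : ℕ) : ℕ∞) := by
      refine (Finset.sum_le_card_nsmul _ _ _ fun k _ => sinkhornStep_time_le hD X₀ r c _).trans ?_
      simp
    have := hD.one_le; have := hD.left; have := hD.right; have := hD.mul
    rw [e, h4]
    set a := Fintype.card m with ha
    set b := Fintype.card n with hb
    simp only [Finset.sum_const, Finset.card_univ, nsmul_eq_mul, ← ha, ← hb]
    -- The initialization, `T + 1` evaluations of the guard and `T` passes.
    calc _ ≤ (a : ℕ∞) * (b * (1 + 1) + 1) + (a * (b * (1 + 1) + 1) + (a * (0 + 1) + (b * (0 + 1) +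
          ((((T + 1) * (20 * D) : ℕ) : ℕ∞) + ((T * (30 * D) : ℕ) : ℕ∞) + 0)))) := by gcongr
      _ ≤ _ := by
        norm_cast
        nlinarith

end Times

/-! ### Entropic optimal transport between positive marginals -/

section ApproxOT

variable {m n : Type} [Fintype m] [Fintype n]

/-- The transport cost minus `1/ξ` times the entropy. -/
noncomputable def entropicCost (C : Matrix m n ℝ) (ξ : ℝ) (X : Matrix m n ℝ) : ℝ :=
  ∑ i, ∑ j, (X i j * C i j + 1 / ξ * (X i j * Real.log (X i j)))

lemma le_iSup_iSup_abs (C : Matrix m n ℝ) (i : m) (j : n) : |C i j| ≤ ⨆ i, ⨆ j, |C i j| :=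
  (le_ciSup (Finite.bddAbove_range fun j => |C i j|) j).trans
    (le_ciSup (Finite.bddAbove_range fun i => ⨆ j, |C i j|) i)

/-- The Gibbs kernel of mass one. -/
noncomputable def gibbsKernel (C : Matrix m n ℝ) (ξ : ℝ) : Matrix m n ℝ :=
  fun i j => Real.exp (0 - ξ * C i j) / ∑ i, ∑ j, |Real.exp (0 - ξ * C i j)|

variable {C : Matrix m n ℝ} {r : m → ℝ} {c : n → ℝ} {ξ N b : ℝ}

lemma isSinkhornData_gibbsKernel [Nonempty m] [Nonempty n] (hξ : 0 < ξ) (hN : 0 ≤ N)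
    (hC : ∀ i j, |C i j| ≤ N) (hb : 0 < b) (hbr : ∀ i, b ≤ r i) (hbc : ∀ j, b ≤ c j)
    (hr : ∑ i, r i = 1) (hc : ∑ j, c j = 1) :
    IsSinkhornData (gibbsKernel C ξ) r c b (2 * (ξ * N)) := by
  have hpos : 0 < ∑ i, ∑ j, |Real.exp (0 - ξ * C i j)| :=
    Finset.sum_pos (fun i _ => Finset.sum_pos (fun j _ => abs_pos.2 (Real.exp_pos _).ne')
      Finset.univ_nonempty) Finset.univ_nonempty
  refine ⟨fun i j => div_pos (Real.exp_pos _) hpos, ?_, fun i j i' j' => ?_, hb, ?_,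
    by positivity, hbr, hbc, hr, hc⟩
  · simp only [gibbsKernel, ← Finset.sum_div]
    simp only [Real.abs_exp] at hpos ⊢
    exact div_self hpos.ne'
  · simp only [gibbsKernel]
    rw [← mul_div_assoc, ← Real.exp_add]
    gcongr
    have h1 := mul_le_mul_of_nonneg_left (abs_le.1 (hC i j)).1 hξ.le
    have h2 := mul_le_mul_of_nonneg_left (abs_le.1 (hC i' j')).2 hξ.le
    linarith
  · have i := Classical.arbitrary m
    exact (hbr i).trans (hr ▸ Finset.single_le_sum (fun i _ => hb.le.trans (hbr i))
      (Finset.mem_univ i))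

/-- The numerator is at least `exp (-ξN)`, and the normalizing sum has `|m||n|` terms, each at most
`exp (ξN)`. -/
lemma neg_log_gibbsKernel_le [Nonempty m] [Nonempty n] (hξ : 0 < ξ) (hC : ∀ i j, |C i j| ≤ N)
    (i : m) (j : n) : -Real.log (gibbsKernel C ξ i j) ≤
      2 * (ξ * N) + (Real.log (Fintype.card m) + Real.log (Fintype.card n)) := by
  have hpos : 0 < ∑ i, ∑ j, |Real.exp (0 - ξ * C i j)| :=
    Finset.sum_pos (fun i _ => Finset.sum_pos (fun j _ => abs_pos.2 (Real.exp_pos _).ne')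
      Finset.univ_nonempty) Finset.univ_nonempty
  have hm : (0 : ℝ) < Fintype.card m := by exact_mod_cast Fintype.card_pos
  have hn : (0 : ℝ) < Fintype.card n := by exact_mod_cast Fintype.card_pos
  have h1 : ∀ i j, -(ξ * C i j) ≤ ξ * N ∧ ξ * C i j ≤ ξ * N := fun i j =>
    ⟨by linarith [mul_le_mul_of_nonneg_left (abs_le.1 (hC i j)).1 hξ.le],
      mul_le_mul_of_nonneg_left (abs_le.1 (hC i j)).2 hξ.le⟩
  have h2 : ∑ i, ∑ j, |Real.exp (0 - ξ * C i j)| ≤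
      Fintype.card m * (Fintype.card n * Real.exp (ξ * N)) := by
    calc _ ≤ ∑ _i : m, ∑ _j : n, Real.exp (ξ * N) := by
          refine Finset.sum_le_sum fun i _ => Finset.sum_le_sum fun j _ => ?_
          rw [Real.abs_exp, zero_sub]
          exact Real.exp_le_exp.2 (h1 i j).1
      _ = _ := by simp
  have h3 := Real.log_le_log hpos h2
  rw [Real.log_mul hm.ne' (by positivity), Real.log_mul hn.ne' (by positivity), Real.log_exp] at h3
  rw [gibbsKernel, Real.log_div (Real.exp_pos _).ne' hpos.ne', Real.log_exp]
  linarith [(h1 i j).2]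

/-- Since `-log X₀` is `ξ * C` plus the logarithm of the normalizing sum, the divergence and the
entropic cost have the same minimizers among matrices of mass one. -/
lemma kernelDivergence_gibbsKernel [Nonempty m] [Nonempty n] (hξ : 0 < ξ) (X : Matrix m n ℝ) :
    kernelDivergence (gibbsKernel C ξ) X = ξ * entropicCost C ξ X +
      Real.log (∑ i, ∑ j, |Real.exp (0 - ξ * C i j)|) * ∑ i, ∑ j, X i j := by
  have hpos : 0 < ∑ i, ∑ j, |Real.exp (0 - ξ * C i j)| :=
    Finset.sum_pos (fun i _ => Finset.sum_pos (fun j _ => abs_pos.2 (Real.exp_pos _).ne')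
      Finset.univ_nonempty) Finset.univ_nonempty
  simp only [kernelDivergence, entropicCost, Finset.mul_sum]
  rw [← Finset.sum_add_distrib]
  refine Finset.sum_congr rfl fun i _ => ?_
  rw [← Finset.sum_add_distrib]
  refine Finset.sum_congr rfl fun j _ => ?_
  rw [gibbsKernel, Real.log_div (Real.exp_pos _).ne' hpos.ne', Real.log_exp]
  field_simp
  ring

lemma marginalError_eq_zero_of_subsingleton [Subsingleton m] [Subsingleton n] {X : Matrix m n ℝ}
    (hX : ∑ i, ∑ j, X i j = 1) (hr : ∑ i, r i = 1) (hc : ∑ j, c j = 1) :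
    marginalError r c X = 0 := by
  have h1 : ∀ i, ∑ j, X i j - r i = 0 := fun i => by
    rw [Fintype.sum_subsingleton _ i] at hX hr; rw [hX, hr, sub_self]
  have h2 : ∀ j, ∑ i, X i j - c j = 0 := fun j => by
    have hX' := (Finset.sum_comm (f := fun j i => X i j)).trans hX
    rw [Fintype.sum_subsingleton _ j] at hX' hc; rw [hX', hc, sub_self]
  simp [marginalError, h1, h2]

/-- This keeps `J` away from zero as soon as one of the supports has two points. -/
lemma le_half_of_sum_eq_one [Nontrivial m] (hbr : ∀ i, b ≤ r i) (hb : 0 ≤ b) (hr : ∑ i, r i = 1) :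
    b ≤ 1 / 2 := by
  classical
  obtain ⟨i, i', h⟩ := exists_pair_ne m
  have := Finset.sum_le_sum_of_subset_of_nonneg (Finset.subset_univ {i, i'})
    fun k _ _ => hb.trans (hbr k)
  rw [Finset.sum_pair h, hr] at this
  linarith [hbr i, hbr i']

lemma IsCoupling.eq_of_subsingleton [Subsingleton n] {X Y : Matrix m n ℝ} (hX : IsCoupling r c X)
    (hY : IsCoupling r c Y) : X = Y := by
  funext i j
  have h1 := hX.row i
  have h2 := hY.row i
  rw [Fintype.sum_subsingleton _ j] at h1 h2
  rw [h1, h2]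

lemma approxOTPos_val (r : m → ℝ) (c : n → ℝ) (C : Matrix m n ℝ) (ξ ε : ℝ) :
    (approxOTPos r c C ξ ε).val = (roundCoupling (sinkhorn (fun i j => Real.exp (0 - ξ * C i j)) r c
      (ε * ε / (8 * (ξ * (⨆ i, ⨆ j, |C i j|) - Real.log (min (⨅ i, r i) (⨅ j, c j)))))).val
      r c).val := rfl

lemma approxOTPos_time_le {D : ℕ} (hD : IsSizeBound m n D) (r : m → ℝ) (c : n → ℝ)
    (C : Matrix m n ℝ) (ξ ε : ℝ) :
    (approxOTPos r c C ξ ε).time ≤ ((70 * D : ℕ) : ℕ∞) +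
      (sinkhorn (fun i j => Real.exp (0 - ξ * C i j)) r c
      (ε * ε / (8 * (ξ * (⨆ i, ⨆ j, |C i j|) - Real.log (min (⨅ i, r i) (⨅ j, c j)))))).time := by
  have e : (approxOTPos r c C ξ ε).time = ∑ _i : m, (∑ _j : n, ((1 : ℕ∞) + 1) + 1) +
      (∑ _i : m, (0 + 1) + (∑ _j : n, (0 + 1) + (1 + (1 + (1 + (1 + (1 + (1 + (1 +
      (∑ _i : m, (∑ _j : n, (1 + (1 + 1) + 1) + 1) +
      ((sinkhorn (fun i j => Real.exp (0 - ξ * C i j)) r c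
      (ε * ε / (8 * (ξ * (⨆ i, ⨆ j, |C i j|) - Real.log (min (⨅ i, r i) (⨅ j, c j)))))).time +
      (roundCoupling (sinkhorn (fun i j => Real.exp (0 - ξ * C i j)) r c
      (ε * ε / (8 * (ξ * (⨆ i, ⨆ j, |C i j|) - Real.log (min (⨅ i, r i) (⨅ j, c j)))))).val
      r c).time))))))))))) := rfl
  have hR := roundCoupling_time_le hD (sinkhorn (fun i j => Real.exp (0 - ξ * C i j)) r c
      (ε * ε / (8 * (ξ * (⨆ i, ⨆ j, |C i j|) - Real.log (min (⨅ i, r i) (⨅ j, c j)))))).val r c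
  rw [e]
  generalize (sinkhorn (fun i j => Real.exp (0 - ξ * C i j)) r c
      (ε * ε / (8 * (ξ * (⨆ i, ⨆ j, |C i j|) - Real.log (min (⨅ i, r i) (⨅ j, c j)))))).time = S
  have := hD.one_le; have := hD.left; have := hD.right; have := hD.mul
  set x := Fintype.card m with hx
  set y := Fintype.card n with hy
  simp only [Finset.sum_const, Finset.card_univ, nsmul_eq_mul, ← hx, ← hy]
  have key : x * (y * (1 + 1) + 1) + (x * (0 + 1) + (y * (0 + 1) + (1 + (1 + (1 + (1 + (1 + (1 + (1 +
      (x * (y * (1 + (1 + 1) + 1) + 1) + 50 * D)))))))))) ≤ 70 * D := by nlinarith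
  calc _ ≤ (x : ℕ∞) * (y * (1 + 1) + 1) + (x * (0 + 1) + (y * (0 + 1) + (1 + (1 + (1 + (1 + (1 +
        (1 + (1 + (x * (y * (1 + (1 + 1) + 1) + 1) + (S + ((50 * D : ℕ) : ℕ∞)))))))))))) := by gcongr
    _ = ((x * (y * (1 + 1) + 1) + (x * (0 + 1) + (y * (0 + 1) + (1 + (1 + (1 + (1 + (1 + (1 + (1 +
      (x * (y * (1 + (1 + 1) + 1) + 1) + 50 * D)))))))))) : ℕ) : ℕ∞) + S := by push_cast; ring
    _ ≤ _ := by gcongr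

lemma approxOTPos_spec {D : ℕ} (hD : IsSizeBound m n D) {ε : ℝ} (hξ : 0 < ξ) (hε : 0 < ε)
    (hN : 0 ≤ N) (hC : ∀ i j, |C i j| ≤ N) (hb : 0 < b) (hbr : ∀ i, b ≤ r i) (hbc : ∀ j, b ≤ c j)
    (hr : ∑ i, r i = 1) (hc : ∑ j, c j = 1) :
    IsCoupling r c (approxOTPos r c C ξ ε).val ∧ (∀ i j, 0 < (approxOTPos r c C ξ ε).val i j) ∧
    (∃ X, IsCoupling r c X ∧
      (∀ X', IsCoupling r c X' → entropicCost C ξ X ≤ entropicCost C ξ X') ∧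
      ∑ i, ∑ j, |(approxOTPos r c C ξ ε).val i j - X i j| ≤ ε) ∧
    ∃ T : ℕ, (approxOTPos r c C ξ ε).time ≤ ((130 * D * (T + 1) : ℕ) : ℕ∞) ∧
      (T : ℝ) ≤ 1 + 256 * (2 * (ξ * N) + (Real.log (Fintype.card m) + Real.log (Fintype.card n))) *
        (ξ * N - Real.log b) ^ 2 / ε ^ 4 := by
  have : Nonempty m := by
    by_contra hm
    rw [not_nonempty_iff] at hm
    simp at hr
  have : Nonempty n := by
    by_contra hm
    rw [not_nonempty_iff] at hm
    simp at hc
  have hval := approxOTPos_val r c C ξ ε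
  have htime := approxOTPos_time_le hD r c C ξ ε
  -- `N'` and `b'` are the quantities the algorithm computes; `N` and `b` bound them and enter the
  -- conclusion only through the estimate of `T`.
  set N' := ⨆ i, ⨆ j, |C i j| with hN'
  set b' := min (⨅ i, r i) (⨅ j, c j) with hb'
  set J := ξ * N' - Real.log b' with hJ
  set ε' := ε * ε / (8 * J) with hε'
  have hN'0 : 0 ≤ N' := (abs_nonneg _).trans
    (le_iSup_iSup_abs C (Classical.arbitrary m) (Classical.arbitrary n))
  have hN'N : N' ≤ N := ciSup_le fun i => ciSup_le fun j => hC i j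
  have hbb' : b ≤ b' := le_min (le_ciInf hbr) (le_ciInf hbc)
  have hb'0 : 0 < b' := hb.trans_le hbb'
  have hb'r : ∀ i, b' ≤ r i := fun i =>
    (min_le_left _ _).trans (ciInf_le (Finite.bddBelow_range r) i)
  have hb'c : ∀ j, b' ≤ c j := fun j =>
    (min_le_right _ _).trans (ciInf_le (Finite.bddBelow_range c) j)
  have hdata := isSinkhornData_gibbsKernel hξ hN'0 (le_iSup_iSup_abs C) hb'0 hb'r hb'c hr hc
  have hlog : Real.log b' ≤ 0 := Real.log_nonpos hb'0.le hdata.b_le_one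
  have hξN : 0 ≤ ξ * N' := mul_nonneg hξ.le hN'0
  have hJ0 : 0 ≤ J := by linarith
  have hε'0 : 0 ≤ ε' := by positivity
  have hmass : ∀ k, ∑ i, ∑ j, (sinkhornIter (gibbsKernel C ξ) r c k).X i j = 1 := fun k => by
    rw [(sinkhornInvariant_iter hdata k).eq_scaling]
    exact (sinkhornInvariant_iter hdata k).balanced.mass
  -- Between one-point sets `J` may be `0`, and then `ε' = 0` since division by zero gives zero.
  -- There the initial matrix already has exact marginals, so the loop stops at once.
  have hcase : (Subsingleton m ∧ Subsingleton n) ∨ Real.log 2 ≤ J := by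
    have hlog2 : b' ≤ 1 / 2 → Real.log 2 ≤ J := fun h => by
      have := Real.log_le_log hb'0 h
      rw [one_div, Real.log_inv] at this
      linarith
    rcases subsingleton_or_nontrivial m with h1 | h1
    · rcases subsingleton_or_nontrivial n with h2 | h2
      · exact Or.inl ⟨h1, h2⟩
      · exact Or.inr (hlog2 (le_half_of_sum_eq_one hb'c hb'0.le hc))
    · exact Or.inr (hlog2 (le_half_of_sum_eq_one hb'r hb'0.le hr))
  have hlog2 : (1 : ℝ) / 2 < Real.log 2 := by linarith [Real.log_two_gt_d9]
  have hex : ∃ k, marginalError r c (sinkhornIter (gibbsKernel C ξ) r c k).X ≤ ε' := by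
    rcases hcase with ⟨_, _⟩ | h
    · exact ⟨0, (marginalError_eq_zero_of_subsingleton (hmass 0) hr hc).trans_le hε'0⟩
    · exact exists_marginalError_le hdata (by have : 0 < J := by linarith
                                              positivity)
  obtain ⟨T, hT1, hT2, hT3, hT4⟩ := sinkhorn_spec hD (K := fun i j => Real.exp (0 - ξ * C i j))
    (X₀ := gibbsKernel C ξ) rfl hex
  rw [hT3] at hval
  obtain ⟨X, hX1, hX2, hX3⟩ := exists_optimal_near_iter hdata
  have hround := roundCoupling_spec (F := (sinkhornIter (gibbsKernel C ξ) r c T).X)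
    (fun i j => by
      rw [(sinkhornInvariant_iter hdata T).eq_scaling]
      exact diagonalScaling_pos hdata.kernel_pos _ _ i j)
    (hmass T) hdata.left_pos hdata.right_pos hr hc
  rw [← hval] at hround
  obtain ⟨hG1, hG2, hG3⟩ := hround
  refine ⟨hG1, hG2, ⟨X, hX1, fun X' hX' => ?_, ?_⟩, T, ?_, ?_⟩
  · have := hX2 X' hX'
    rw [kernelDivergence_gibbsKernel hξ, kernelDivergence_gibbsKernel hξ, hX1.sum_eq hr,
      hX'.sum_eq hr] at this
    exact le_of_mul_le_mul_left (by linarith) hξ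
  · rcases hcase with ⟨_, _⟩ | h
    · rw [hG1.eq_of_subsingleton hX1]; simpa using hε.le
    · have hJpos : 0 < J := by linarith
      -- Two couplings of probability vectors are never more than `2` apart. For `ε < 2`, the bound
      -- `J > 1/2` gives `ε' ≤ ε / 2`.
      rcases le_or_gt 2 ε with h2 | h2
      · calc _ ≤ ∑ i, ∑ j, ((approxOTPos r c C ξ ε).val i j + X i j) := by
              refine Finset.sum_le_sum fun i _ => Finset.sum_le_sum fun j _ => ?_
              rw [abs_le]
              constructor <;> linarith [hG1.nonneg i j, hX1.nonneg i j]
          _ = 2 := by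
              simp only [Finset.sum_add_distrib]
              rw [hG1.sum_eq hr, hX1.sum_eq hr]; norm_num
          _ ≤ ε := h2
      · have hEJ : ε' * (8 * J) = ε * ε := by rw [hε']; field_simp
        have hle1 : ε' ≤ ε / 2 := by
          rw [hε', div_le_iff₀ (by positivity)]
          nlinarith
        have hle2 : ∑ i, ∑ j, |(sinkhornIter (gibbsKernel C ξ) r c T).X i j - X i j| ≤ ε / 2 := by
          refine abs_le_of_sq_le_sq' ?_ (by positivity) |>.2
          refine (hX3 T).trans ?_
          -- The oscillation bound `2ξN' - log b'` is at most `2J` because `log b' ≤ 0`.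
          calc _ ≤ (2 * J) * ε' := mul_le_mul (by linarith) hT2 (marginalError_nonneg _ _ _)
                (by positivity)
            _ = (ε / 2) ^ 2 := by linarith
        calc _ ≤ ∑ i, ∑ j, (|(approxOTPos r c C ξ ε).val i j -
                (sinkhornIter (gibbsKernel C ξ) r c T).X i j| +
                |(sinkhornIter (gibbsKernel C ξ) r c T).X i j - X i j|) :=
              Finset.sum_le_sum fun i _ => Finset.sum_le_sum fun j _ => abs_sub_le _ _ _
          _ ≤ ε' + ε / 2 := by
              simp only [Finset.sum_add_distrib]
              exact add_le_add (hG3.trans hT2) hle2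
          _ ≤ ε := by linarith
  · refine htime.trans ((add_le_add_right hT4 _).trans ?_)
    norm_cast
    nlinarith [hD.one_le, Nat.zero_le (D * T)]
  · have hm1 : 0 ≤ Real.log (Fintype.card m) := Real.log_natCast_nonneg _
    have hn1 : 0 ≤ Real.log (Fintype.card n) := Real.log_natCast_nonneg _
    have hlogb : Real.log b ≤ Real.log b' := Real.log_le_log hb hbb'
    have hξNN : ξ * N' ≤ ξ * N := mul_le_mul_of_nonneg_left hN'N hξ.le
    rcases hcase with ⟨_, _⟩ | h
    · have : T = 0 := by
        by_contra hT
        have := hT1 0 (Nat.pos_of_ne_zero hT)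
        rw [marginalError_eq_zero_of_subsingleton (hmass 0) hr hc] at this
        linarith
      rw [this, Nat.cast_zero]
      positivity
    · have hJpos : 0 < J := by linarith
      have h1 := le_of_forall_lt_marginalError hdata (by positivity)
        (neg_log_gibbsKernel_le hξ (le_iSup_iSup_abs C)) hT1
      refine h1.trans ?_
      -- The constant is `4 * 8 ^ 2`, the `8` coming from `ε' = ε²/(8J)`.
      have e : 4 * (2 * (ξ * N') + (Real.log (Fintype.card m) + Real.log (Fintype.card n))) /
          ε' ^ 2 = 256 * (2 * (ξ * N') + (Real.log (Fintype.card m) + Real.log (Fintype.card n))) *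
            J ^ 2 / ε ^ 4 := by
        rw [hε']; field_simp; ring
      rw [e]
      gcongr
      linarith

end ApproxOT

/-! ### Restriction to the support and extension by zero -/

section Extend

variable {m n : Type} {I : m → Bool} {J : n → Bool}

/-- Extension of a matrix by zero, from the rows `I` and columns `J`. -/
noncomputable def extendZero (I : m → Bool) (J : n → Bool)
    (X : Matrix {i // I i = true} {j // J j = true} ℝ) : Matrix m n ℝ :=
  fun i j => if h : I i = true ∧ J j = true then X ⟨i, h.1⟩ ⟨j, h.2⟩ else 0

lemma extendZero_coe (X : Matrix {i // I i = true} {j // J j = true} ℝ) (i : {i // I i = true})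
    (j : {j // J j = true}) : extendZero I J X i j = X i j := by
  simp [extendZero, i.2, j.2]

lemma extendZero_of_left (X : Matrix {i // I i = true} {j // J j = true} ℝ) {i : m} (j : n)
    (h : ¬I i = true) : extendZero I J X i j = 0 := dif_neg fun h' => h h'.1

lemma extendZero_of_right (X : Matrix {i // I i = true} {j // J j = true} ℝ) (i : m) {j : n}
    (h : ¬J j = true) : extendZero I J X i j = 0 := dif_neg fun h' => h h'.2

variable [Fintype m] [Fintype n]

lemma sum_eq_sum_subtype {ι : Type} [Fintype ι] {I : ι → Bool} {g : ι → ℝ}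
    (hg : ∀ i, ¬I i = true → g i = 0) : ∑ i, g i = ∑ i : {i // I i = true}, g i := by
  rw [← Fintype.sum_subtype_add_sum_subtype (fun i => I i = true) g, add_eq_left]
  exact Finset.sum_eq_zero fun i _ => hg _ i.2

variable {r : m → ℝ} {c : n → ℝ}

/-- Restriction of double sums to the support. -/
lemma sum_sum_eq_sum_sum_subtype {g : m → n → ℝ}
    (hI : ∀ i j, ¬I i = true → g i j = 0) (hJ : ∀ i j, ¬J j = true → g i j = 0) :
    ∑ i, ∑ j, g i j = ∑ i : {i // I i = true}, ∑ j : {j // J j = true}, g i j := by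
  rw [sum_eq_sum_subtype (I := I) fun i hi => Finset.sum_eq_zero fun j _ => hI i j hi]
  exact Finset.sum_congr rfl fun i _ => sum_eq_sum_subtype fun j hj => hJ i j hj

lemma IsCoupling.extendZero (hr : ∀ i, ¬I i = true → r i = 0) (hc : ∀ j, ¬J j = true → c j = 0)
    {X : Matrix {i // I i = true} {j // J j = true} ℝ}
    (hX : IsCoupling (fun i : {i // I i = true} => r i) (fun j : {j // J j = true} => c j) X) :
    IsCoupling r c (extendZero I J X) where
  nonneg i j := by
    unfold _root_.extendZero
    split_ifs
    · exact hX.nonneg _ _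
    · exact le_rfl
  row i := by
    by_cases hi : I i = true
    · rw [sum_eq_sum_subtype (I := J) fun j hj => extendZero_of_right X i hj]
      rw [← hX.row ⟨i, hi⟩]
      exact Finset.sum_congr rfl fun j _ => extendZero_coe X ⟨i, hi⟩ j
    · rw [hr i hi]
      exact Finset.sum_eq_zero fun j _ => extendZero_of_left X j hi
  col j := by
    by_cases hj : J j = true
    · rw [sum_eq_sum_subtype (I := I) fun i hi => extendZero_of_left X j hi]
      rw [← hX.col ⟨j, hj⟩]
      exact Finset.sum_congr rfl fun i _ => extendZero_coe X i ⟨j, hj⟩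
    · rw [hc j hj]
      exact Finset.sum_eq_zero fun i _ => extendZero_of_right X i hj

lemma IsCoupling.eq_zero_of_left {X : Matrix m n ℝ} (hX : IsCoupling r c X) {i : m}
    (h : r i = 0) (j : n) : X i j = 0 :=
  (Finset.sum_eq_zero_iff_of_nonneg fun j _ => hX.nonneg i j).1 ((hX.row i).trans h) j
    (Finset.mem_univ j)

lemma IsCoupling.eq_zero_of_right {X : Matrix m n ℝ} (hX : IsCoupling r c X) (i : m) {j : n}
    (h : c j = 0) : X i j = 0 :=
  (Finset.sum_eq_zero_iff_of_nonneg fun i _ => hX.nonneg i j).1 ((hX.col j).trans h) i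
    (Finset.mem_univ i)

/-- A coupling vanishes wherever a marginal does, so restriction loses nothing and every competitor
on the full index set is seen on the supports. -/
lemma IsCoupling.restrict (hr : ∀ i, ¬I i = true → r i = 0) (hc : ∀ j, ¬J j = true → c j = 0)
    {X : Matrix m n ℝ} (hX : IsCoupling r c X) :
    IsCoupling (fun i : {i // I i = true} => r i) (fun j : {j // J j = true} => c j)
      fun i j => X i j where
  nonneg i j := hX.nonneg i j
  row i := by
    rw [← hX.row i, sum_eq_sum_subtype (I := J) fun j hj => hX.eq_zero_of_right i (hc j hj)]
  col j := by
    rw [← hX.col j, sum_eq_sum_subtype (I := I) fun i hi => hX.eq_zero_of_left (hr i hi) j]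

/-- A zero entry contributes nothing to the cost or, since `0 * log 0 = 0`, to the entropy. -/
lemma entropicCost_eq_restrict {C X : Matrix m n ℝ} {ξ : ℝ}
    (hI : ∀ i j, ¬I i = true → X i j = 0) (hJ : ∀ i j, ¬J j = true → X i j = 0) :
    entropicCost C ξ X = entropicCost (fun (i : {i // I i = true}) (j : {j // J j = true}) => C i j)
      ξ fun i j => X i j := by
  unfold entropicCost
  exact sum_sum_eq_sum_sum_subtype (fun i j h => by simp [hI i j h])
    (fun i j h => by simp [hJ i j h])

lemma entropicCost_extendZero (C : Matrix m n ℝ) (ξ : ℝ)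
    (X : Matrix {i // I i = true} {j // J j = true} ℝ) :
    entropicCost C ξ (extendZero I J X) =
      entropicCost (fun (i : {i // I i = true}) (j : {j // J j = true}) => C i j) ξ X := by
  rw [entropicCost_eq_restrict (I := I) (J := J) (fun _ j h => extendZero_of_left X j h)
    (fun i _ h => extendZero_of_right X i h)]
  simp only [extendZero_coe]

lemma sum_abs_extendZero_sub (X Y : Matrix {i // I i = true} {j // J j = true} ℝ) :
    ∑ i, ∑ j, |extendZero I J X i j - extendZero I J Y i j| = ∑ i, ∑ j, |X i j - Y i j| := by
  rw [sum_sum_eq_sum_sum_subtype (I := I) (J := J)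
    (fun i j h => by simp only [extendZero_of_left _ _ h, sub_self, abs_zero])
    (fun i j h => by simp only [extendZero_of_right _ _ h, sub_self, abs_zero])]
  simp only [extendZero_coe]

lemma approxOT_val (r : m → ℝ) (c : n → ℝ) (C : Matrix m n ℝ) (ξ ε : ℝ) :
    (approxOT r c C ξ ε).val = extendZero (fun i => decide (0 < r i)) (fun j => decide (0 < c j))
      (approxOTPos (fun i : {i // decide (0 < r i) = true} => r i)
        (fun j : {j // decide (0 < c j) = true} => c j) (fun i j => C i j) ξ ε).val := rfl

lemma approxOT_time_le {D : ℕ} (hD : IsSizeBound m n D) (r : m → ℝ) (c : n → ℝ)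
    (C : Matrix m n ℝ) (ξ ε : ℝ) :
    (approxOT r c C ξ ε).time ≤ ((20 * D : ℕ) : ℕ∞) +
      (approxOTPos (fun i : {i // decide (0 < r i) = true} => r i)
        (fun j : {j // decide (0 < c j) = true} => c j) (fun i j => C i j) ξ ε).time := by
  have e : (approxOT r c C ξ ε).time = ∑ _i : m, ((1 : ℕ∞) + 1) + (∑ _j : n, (1 + 1) +
      (∑ _i : {i // decide (0 < r i) = true}, (0 + 1) +
      (∑ _j : {j // decide (0 < c j) = true}, (0 + 1) +
      (∑ _i : {i // decide (0 < r i) = true},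
        (∑ _j : {j // decide (0 < c j) = true}, (0 + 1) + 1) +
      ((approxOTPos (fun i : {i // decide (0 < r i) = true} => r i)
        (fun j : {j // decide (0 < c j) = true} => c j) (fun i j => C i j) ξ ε).time +
      ∑ _i : m, (∑ _j : n, (0 + 1) + 1)))))) := rfl
  rw [e]
  generalize (approxOTPos (fun i : {i // decide (0 < r i) = true} => r i)
        (fun j : {j // decide (0 < c j) = true} => c j) (fun i j => C i j) ξ ε).time = S
  have := hD.one_le; have := hD.left; have := hD.right; have := hD.mul
  have hx := Fintype.card_subtype_le fun i => decide (0 < r i) = true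
  have hy := Fintype.card_subtype_le fun j => decide (0 < c j) = true
  set x := Fintype.card m
  set y := Fintype.card n
  simp only [Finset.sum_const, Finset.card_univ, nsmul_eq_mul]
  set x' := Fintype.card {i // decide (0 < r i) = true}
  set y' := Fintype.card {j // decide (0 < c j) = true}
  have hxy : x' * y' ≤ x * y := Nat.mul_le_mul hx hy
  have key : x * (1 + 1) + (y * (1 + 1) + (x' * (0 + 1) + (y' * (0 + 1) +
      (x' * (y' * (0 + 1) + 1) + x * (y * (0 + 1) + 1))))) ≤ 20 * D := by nlinarith
  calc _ = ((x * (1 + 1) + (y * (1 + 1) + (x' * (0 + 1) + (y' * (0 + 1) +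
      (x' * (y' * (0 + 1) + 1) + x * (y * (0 + 1) + 1))))) : ℕ) : ℕ∞) + S := by push_cast; ring
    _ ≤ _ := by gcongr

lemma IsSizeBound.subtype {D : ℕ} (hD : IsSizeBound m n D) (I : m → Bool) (J : n → Bool) :
    IsSizeBound {i // I i = true} {j // J j = true} D where
  one_le := hD.one_le
  left := (Fintype.card_subtype_le _).trans hD.left
  right := (Fintype.card_subtype_le _).trans hD.right
  mul := (Nat.mul_le_mul (Fintype.card_subtype_le _) (Fintype.card_subtype_le _)).trans hD.mul

lemma approxOT_spec {D d : ℕ} (hD : IsSizeBound m n D) (hdm : Fintype.card m ≤ d)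
    (hdn : Fintype.card n ≤ d) {C : Matrix m n ℝ} {ξ ε N b : ℝ} (hξ : 0 < ξ) (hε : 0 < ε)
    (hN : 0 ≤ N) (hC : ∀ i j, |C i j| ≤ N) (hb : 0 < b) (hr0 : ∀ i, 0 ≤ r i) (hc0 : ∀ j, 0 ≤ c j)
    (hbr : ∀ i, 0 < r i → b ≤ r i) (hbc : ∀ j, 0 < c j → b ≤ c j)
    (hr : ∑ i, r i = 1) (hc : ∑ j, c j = 1) :
    IsCoupling r c (approxOT r c C ξ ε).val ∧
    (∀ i j, 0 < r i → 0 < c j → 0 < (approxOT r c C ξ ε).val i j) ∧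
    (∃ X, IsCoupling r c X ∧
      (∀ X', IsCoupling r c X' → entropicCost C ξ X ≤ entropicCost C ξ X') ∧
      ∑ i, ∑ j, |(approxOT r c C ξ ε).val i j - X i j| ≤ ε) ∧
    ∃ T : ℕ, (approxOT r c C ξ ε).time ≤ ((150 * D * (T + 1) : ℕ) : ℕ∞) ∧
      (T : ℝ) ≤ 1 + 512 * (ξ * N + Real.log d) * (ξ * N - Real.log b) ^ 2 / ε ^ 4 := by
  have htime := approxOT_time_le hD r c C ξ ε
  rw [approxOT_val]
  have hIr : ∀ i, ¬decide (0 < r i) = true → r i = 0 := fun i h =>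
    le_antisymm (by simpa using h) (hr0 i)
  have hJc : ∀ j, ¬decide (0 < c j) = true → c j = 0 := fun j h =>
    le_antisymm (by simpa using h) (hc0 j)
  have hIr' : ∀ i, decide (0 < r i) = true → 0 < r i := fun i h => by simpa using h
  have hJc' : ∀ j, decide (0 < c j) = true → 0 < c j := fun j h => by simpa using h
  have hcm := Fintype.card_subtype_le fun i => decide (0 < r i) = true
  have hcn := Fintype.card_subtype_le fun j => decide (0 < c j) = true
  have hsr : ∑ i : {i // decide (0 < r i) = true}, r i = 1 := by
    rw [← hr, sum_eq_sum_subtype hIr]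
  have hsc : ∑ j : {j // decide (0 < c j) = true}, c j = 1 := by
    rw [← hc, sum_eq_sum_subtype hJc]
  have hspec := approxOTPos_spec (r := fun i : {i // decide (0 < r i) = true} => r i)
    (c := fun j : {j // decide (0 < c j) = true} => c j)
    (C := fun (i : {i // decide (0 < r i) = true}) (j : {j // decide (0 < c j) = true}) => C i j)
    (hD.subtype _ _) hξ hε hN (fun i j => hC i j) hb
    (fun i => hbr i (hIr' i i.2)) (fun j => hbc j (hJc' j j.2)) hsr hsc
  generalize approxOTPos (fun i : {i // decide (0 < r i) = true} => r i)
    (fun j : {j // decide (0 < c j) = true} => c j) (fun i j => C i j) ξ ε = G at hspec htime ⊢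
  obtain ⟨h1, h2, ⟨X, hX1, hX2, hX3⟩, T, hT1, hT2⟩ := hspec
  refine ⟨h1.extendZero hIr hJc, fun i j hi hj => ?_,
    ⟨_, hX1.extendZero hIr hJc, fun X' hX' => ?_, ?_⟩, T, ?_, ?_⟩
  · have := extendZero_coe (I := fun i => decide (0 < r i)) (J := fun j => decide (0 < c j)) G.val
      ⟨i, decide_eq_true hi⟩ ⟨j, decide_eq_true hj⟩
    rw [this]
    exact h2 _ _
  · rw [entropicCost_extendZero, entropicCost_eq_restrict (X := X')
      (I := fun i => decide (0 < r i)) (J := fun j => decide (0 < c j))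
      (fun i j h => hX'.eq_zero_of_left (hIr i h) j)
      (fun i j h => hX'.eq_zero_of_right i (hJc j h))]
    exact hX2 _ (hX'.restrict hIr hJc)
  · exact (sum_abs_extendZero_sub G.val X).trans_le hX3
  · refine htime.trans ((add_le_add_right hT1 _).trans ?_)
    norm_cast
    nlinarith [hD.one_le, Nat.zero_le (D * T)]
  · refine hT2.trans ?_
    have lm : Real.log (Fintype.card {i // decide (0 < r i) = true}) ≤ Real.log d := by
      refine Real.log_le_log ?_ (by exact_mod_cast hcm.trans hdm)
      have : Nonempty {i // decide (0 < r i) = true} := by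
        by_contra hm
        rw [not_nonempty_iff] at hm
        simp at hsr
      exact_mod_cast Fintype.card_pos
    have ln : Real.log (Fintype.card {j // decide (0 < c j) = true}) ≤ Real.log d := by
      refine Real.log_le_log ?_ (by exact_mod_cast hcn.trans hdn)
      have : Nonempty {j // decide (0 < c j) = true} := by
        by_contra hm
        rw [not_nonempty_iff] at hm
        simp at hsc
      exact_mod_cast Fintype.card_pos
    -- The logarithms of both support sizes are at most `log d`; factoring out the resulting `2`
    -- turns `256` into `512`.
    gcongr 1 + ?_ / _
    rw [show 512 * (ξ * N + Real.log d) * (ξ * N - Real.log b) ^ 2 =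
      256 * (2 * (ξ * N) + (Real.log d + Real.log d)) * (ξ * N - Real.log b) ^ 2 by ring]
    gcongr

end Extend

/-! ### Transition couplings -/

section TransitionCouplings

variable {𝒳 𝒴 : Type} [Fintype 𝒳] [Fintype 𝒴]

lemma isCoupling_iff_mem_couplings {p : 𝒳 → ℝ} {q : 𝒴 → ℝ} {R : 𝒳 × 𝒴 → ℝ} :
    IsCoupling p q (fun x y => R (x, y)) ↔ R ∈ couplings p q :=
  ⟨fun h => ⟨fun s => h.nonneg s.1 s.2, h.row, h.col⟩,
    fun h => ⟨fun x y => h.1 (x, y), h.2.1, h.2.2⟩⟩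

/-- The decoupling: entry `s` of the objective sees only row `s`, so the rows can be minimized
independently. -/
lemma entropicObjective_eq (h : 𝒳 × 𝒴 → ℝ) (ξ : ℝ) (R : Matrix (𝒳 × 𝒴) (𝒳 × 𝒴) ℝ) (s : 𝒳 × 𝒴) :
    entropicObjective h ξ R s =
      entropicCost (fun x y => h (x, y)) ξ (fun x y => R s (x, y)) := by
  simp only [entropicObjective, rowEntropy, entropicCost, Pi.sub_apply, Pi.smul_apply,
    Matrix.mulVec, dotProduct, smul_eq_mul, mul_neg, sub_neg_eq_add, Finset.mul_sum]
  rw [← Finset.sum_add_distrib, Fintype.sum_prod_type]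

/-- A transition coupling with full support lies in the relative interior. -/
lemma mem_intrinsicInterior_transitionCouplings {P : Matrix 𝒳 𝒳 ℝ} {Q : Matrix 𝒴 𝒴 ℝ}
    {R : Matrix (𝒳 × 𝒴) (𝒳 × 𝒴) ℝ} (hP : ∀ x x', 0 ≤ P x x') (hQ : ∀ y y', 0 ≤ Q y y')
    (hR : R ∈ transitionCouplings P Q)
    (hpos : ∀ s s' : 𝒳 × 𝒴, 0 < P s.1 s'.1 → 0 < Q s.2 s'.2 → 0 < R s s') :
    R ∈ intrinsicInterior ℝ (transitionCouplings P Q) := by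
  rw [mem_intrinsicInterior]
  refine ⟨⟨R, subset_affineSpan ℝ _ hR⟩, ?_, rfl⟩
  rw [mem_interior_iff_mem_nhds]
  -- The marginals and the forced zeros are affine conditions, so they pass to the affine hull; only
  -- nonnegativity on the support can fail there.
  have hspan : ∀ Y ∈ affineSpan ℝ (transitionCouplings P Q), ∀ s : 𝒳 × 𝒴,
      (∀ x, ∑ y, Y s (x, y) = P s.1 x) ∧ (∀ y, ∑ x, Y s (x, y) = Q s.2 y) ∧
        ∀ x y, P s.1 x = 0 ∨ Q s.2 y = 0 → Y s (x, y) = 0 := by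
    intro Y hY
    refine affineSpan_induction hY (fun Y hY s => ?_) fun a U V W hU hV hW s => ?_
    · have hs := isCoupling_iff_mem_couplings.2 (hY s)
      exact ⟨hs.row, hs.col, fun x y h =>
        h.elim (fun h => hs.eq_zero_of_left h y) (fun h => hs.eq_zero_of_right x h)⟩
    · obtain ⟨u1, u2, u3⟩ := hU s
      obtain ⟨v1, v2, v3⟩ := hV s
      obtain ⟨w1, w2, w3⟩ := hW s
      have e : ∀ s', (a • (U -ᵥ V) +ᵥ W) s s' = a * (U s s' - V s s') + W s s' := fun _ => rfl
      simp only [e]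
      refine ⟨fun x => ?_, fun y => ?_, fun x y h => ?_⟩
      · rw [Finset.sum_add_distrib, ← Finset.mul_sum, Finset.sum_sub_distrib, u1, v1, w1]; ring
      · rw [Finset.sum_add_distrib, ← Finset.mul_sum, Finset.sum_sub_distrib, u2, v2, w2]; ring
      · rw [u3 x y h, v3 x y h, w3 x y h]; ring
  -- Each strict inequality on the support is open, and there are finitely many of them.
  have hev : ∀ s s' : 𝒳 × 𝒴, ∀ᶠ Y : affineSpan ℝ (transitionCouplings P Q) in
      nhds ⟨R, subset_affineSpan ℝ _ hR⟩, 0 < P s.1 s'.1 → 0 < Q s.2 s'.2 → 0 < Y.1 s s' := by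
    intro s s'
    by_cases h : 0 < P s.1 s'.1 ∧ 0 < Q s.2 s'.2
    · have hc : Continuous fun Y : affineSpan ℝ (transitionCouplings P Q) => Y.1 s s' :=

          (continuous_apply_apply s s').comp continuous_subtype_val
      exact ((hc.tendsto _).eventually (lt_mem_nhds (hpos s s' h.1 h.2))).mono
        fun Y hY _ _ => hY
    · exact Filter.Eventually.of_forall fun Y h1 h2 => absurd ⟨h1, h2⟩ h
  filter_upwards [Filter.eventually_all.2 fun s => Filter.eventually_all.2 (hev s)] with Y hY
  intro s
  obtain ⟨y1, y2, y3⟩ := hspan Y.1 Y.2 s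
  refine ⟨fun s' => ?_, y1, y2⟩
  rcases (hP s.1 s'.1).eq_or_lt with h1 | h1
  · exact (y3 s'.1 s'.2 (Or.inl h1.symm)).ge
  rcases (hQ s.2 s'.2).eq_or_lt with h2 | h2
  · exact (y3 s'.1 s'.2 (Or.inr h2.symm)).ge
  exact (hY s s' h1 h2).le

/-- The set of positive entries is finite and nonempty, so its infimum is attained. -/
lemma minPosEntry_spec {P : Matrix 𝒳 𝒳 ℝ} (Q : Matrix 𝒴 𝒴 ℝ) (hP : ∃ x x', 0 < P x x') :
    0 < minPosEntry P Q ∧ (∀ x x', 0 < P x x' → minPosEntry P Q ≤ P x x') ∧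
      ∀ y y', 0 < Q y y' → minPosEntry P Q ≤ Q y y' := by
  set S := {b : ℝ | 0 < b ∧ ((∃ x x', P x x' = b) ∨ (∃ y y', Q y y' = b))} with hS
  have hfin : S.Finite := by
    refine ((Set.finite_range fun s : 𝒳 × 𝒳 => P s.1 s.2).union
      (Set.finite_range fun s : 𝒴 × 𝒴 => Q s.1 s.2)).subset ?_
    rintro b ⟨-, ⟨x, x', rfl⟩ | ⟨y, y', rfl⟩⟩
    · exact Or.inl ⟨(x, x'), rfl⟩
    · exact Or.inr ⟨(y, y'), rfl⟩
  obtain ⟨x, x', hx⟩ := hP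
  have hne : S.Nonempty := ⟨P x x', hx, Or.inl ⟨x, x', rfl⟩⟩
  exact ⟨(hne.csInf_mem hfin).1,
    fun x x' h => csInf_le hfin.bddBelow ⟨h, Or.inl ⟨x, x', rfl⟩⟩,
    fun y y' h => csInf_le hfin.bddBelow ⟨h, Or.inr ⟨y, y', rfl⟩⟩⟩

lemma entropicTCI_time_le {P : Matrix 𝒳 𝒳 ℝ} {Q : Matrix 𝒴 𝒴 ℝ} {h : 𝒳 × 𝒴 → ℝ} {ξ ε : ℝ} {B : ℕ}
    (hB : ∀ s : 𝒳 × 𝒴, (approxOT (P s.1) (Q s.2) (fun x' y' => h (x', y')) ξ ε).time ≤ (B : ℕ∞)) :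
    (entropicTCI P Q h ξ ε).time ≤
      ((Fintype.card (𝒳 × 𝒴) * (B + Fintype.card (𝒳 × 𝒴) + 1) : ℕ) : ℕ∞) := by
  have e : (entropicTCI P Q h ξ ε).time = ∑ s : 𝒳 × 𝒴,
      ((approxOT (P s.1) (Q s.2) (fun x' y' => h (x', y')) ξ ε).time +
        ∑ _s' : 𝒳 × 𝒴, (0 + 1) + 1) := rfl
  rw [e]
  calc _ ≤ ∑ _s : 𝒳 × 𝒴, ((B : ℕ∞) + ∑ _s' : 𝒳 × 𝒴, (0 + 1) + 1) :=
        Finset.sum_le_sum fun s _ => by gcongr; exact hB s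
    _ = _ := by
        simp only [Finset.sum_const, Finset.card_univ, nsmul_eq_mul]
        push_cast
        ring

end TransitionCouplings

/-! ### Absorbing the constants, and the theorem -/

/-- All factors on the right are at least `1`, so their product absorbs the constant `2`; the factor
`max 1 ε⁻¹` covers large `ε`, where only that constant matters. Hence `514 = 2 + 512`. -/
lemma two_add_le_mul_pow {a l m ε : ℝ} (ha : 0 ≤ a) (hl : 0 ≤ l) (hm : 0 ≤ m) (hε : 0 < ε) :
    2 + 512 * (a + l) * (a + m) ^ 2 / ε ^ 4 ≤
      514 * (max 1 ε⁻¹) ^ 4 * (1 + l + a) * (1 + a + m) ^ 2 := by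
  have hE1 : 1 ≤ max 1 ε⁻¹ ^ 4 := one_le_pow₀ (le_max_left _ _)
  have hE2 : (ε⁻¹) ^ 4 ≤ max 1 ε⁻¹ ^ 4 := by gcongr; exact le_max_right _ _
  have hL : 1 ≤ 1 + l + a := by linarith
  have hM : 1 ≤ (1 + a + m) ^ 2 := one_le_pow₀ (by linarith)
  have h1 : 1 ≤ max 1 ε⁻¹ ^ 4 * (1 + l + a) * (1 + a + m) ^ 2 :=
    one_le_mul_of_one_le_of_one_le (one_le_mul_of_one_le_of_one_le hE1 hL) hM
  have h2 : (a + l) * (a + m) ^ 2 * (ε⁻¹) ^ 4 ≤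
      (1 + l + a) * (1 + a + m) ^ 2 * max 1 ε⁻¹ ^ 4 := by
    have : a + l ≤ 1 + l + a := by linarith
    have : a + m ≤ 1 + a + m := by linarith
    gcongr
  rw [div_eq_mul_inv, ← inv_pow]
  linarith

theorem mainTheorem4 :
    ∃ A : ℝ, 0 < A ∧
      ∀ (𝒳 𝒴 : Type) [Fintype 𝒳] [Fintype 𝒴] [DecidableEq 𝒳] [DecidableEq 𝒴] (d : ℕ),
        1 ≤ d → Fintype.card 𝒳 = d → Fintype.card 𝒴 = d →
        ∀ (P : Matrix 𝒳 𝒳 ℝ) (Q : Matrix 𝒴 𝒴 ℝ),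
          P ∈ Matrix.rowStochastic ℝ 𝒳 → Q ∈ Matrix.rowStochastic ℝ 𝒴 →
          P.IsIrreducible → Q.IsIrreducible → IsAperiodic P → IsAperiodic Q →
          ∀ (h : 𝒳 × 𝒴 → ℝ) (ξ ε : ℝ), 0 < ξ → 0 < ε →
            (entropicTCI P Q h ξ ε).val ∈ intrinsicInterior ℝ (transitionCouplings P Q) ∧
            (∃ R ∈ entropicMinimizers P Q h ξ,
              ∀ s, ∑ s', |(entropicTCI P Q h ξ ε).val s s' - R s s'| ≤ ε) ∧
            ∃ t : ℕ, (entropicTCI P Q h ξ ε).time = t ∧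
              (t : ℝ) ≤ A * (d : ℝ) ^ 4 * (max 1 ε⁻¹) ^ 4 *
                (1 + Real.log d + ξ * ‖h‖) *
                (1 + ξ * ‖h‖ + Real.log (minPosEntry P Q)⁻¹) ^ 2 := by
  refine ⟨152 * 514, by norm_num, ?_⟩
  intro 𝒳 𝒴 _ _ _ _ d hd hcX hcY P Q hP hQ _ _ _ _ h ξ ε hξ hε
  rw [Matrix.mem_rowStochastic_iff_sum] at hP hQ
  obtain ⟨hP0, hP1⟩ := hP
  obtain ⟨hQ0, hQ1⟩ := hQ
  have hPex : ∃ x x', 0 < P x x' := by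
    obtain ⟨x⟩ : Nonempty 𝒳 := Fintype.card_pos_iff.1 (by omega)
    by_contra! hc
    have := Finset.sum_nonpos fun x' (_ : x' ∈ Finset.univ) => hc x x'
    rw [hP1] at this
    linarith
  obtain ⟨hb0, hbP, hbQ⟩ := minPosEntry_spec Q hPex
  set b := minPosEntry P Q
  have hb1 : b ≤ 1 := by
    obtain ⟨x, x', hx⟩ := hPex
    exact (hbP x x' hx).trans
      (hP1 x ▸ Finset.single_le_sum (fun x' _ => hP0 x x') (Finset.mem_univ x'))
  have hsize : IsSizeBound 𝒳 𝒴 (d ^ 2) :=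
    ⟨Nat.one_le_pow _ _ hd, by nlinarith, by nlinarith, by rw [hcX, hcY]; nlinarith⟩
  have hspec := fun s : 𝒳 × 𝒴 => approxOT_spec (r := P s.1) (c := Q s.2)
    (C := fun x' y' => h (x', y')) (ξ := ξ) (ε := ε) (N := ‖h‖) (b := b) hsize hcX.le hcY.le hξ hε
    (norm_nonneg h) (fun x y => norm_le_pi_norm h (x, y)) hb0 (hP0 s.1) (hQ0 s.2) (hbP s.1)
    (hbQ s.2) (hP1 s.1) (hQ1 s.2)
  choose hcoup hpos hopt T hT1 hT2 using hspec
  -- Each row has its own minimizer; together they form the matrix `R`.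
  choose X hX1 hX2 hX3 using hopt
  refine ⟨mem_intrinsicInterior_transitionCouplings hP0 hQ0
      (fun s => isCoupling_iff_mem_couplings.1 (hcoup s)) fun s s' => hpos s s'.1 s'.2,
    ⟨fun s s' => X s s'.1 s'.2, ⟨fun s => isCoupling_iff_mem_couplings.1 (hX1 s),
      fun R' hR' s => ?_⟩, fun s => ?_⟩, ?_⟩
  · refine (entropicObjective_eq h ξ _ s).trans_le
      (le_trans ?_ (entropicObjective_eq h ξ R' s).ge)
    exact hX2 s _ (isCoupling_iff_mem_couplings.2 (hR' s))
  · rw [Fintype.sum_prod_type]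
    exact hX3 s
  -- `τ` bounds the number of passes for all rows at once; its floor gives a uniform natural number.
  set τ : ℝ := 1 + 512 * (ξ * ‖h‖ + Real.log d) * (ξ * ‖h‖ - Real.log b) ^ 2 / ε ^ 4 with hτ
  have hξh : 0 ≤ ξ * ‖h‖ := mul_nonneg hξ.le (norm_nonneg h)
  have hlogd : 0 ≤ Real.log d := Real.log_natCast_nonneg d
  have hlogb : 0 ≤ Real.log b⁻¹ := Real.log_nonneg ((one_le_inv₀ hb0).2 hb1)
  have hτ0 : 0 ≤ τ := by positivity
  have htime := entropicTCI_time_le (P := P) (Q := Q) (h := h) (ξ := ξ) (ε := ε)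
    (B := 150 * d ^ 2 * (⌊τ⌋₊ + 1)) fun s => (hT1 s).trans (by
      have := Nat.le_floor (hT2 s)
      exact_mod_cast Nat.mul_le_mul_left _ (Nat.succ_le_succ this))
  obtain ⟨t, ht, htle⟩ := ENat.le_natCast_iff.1 htime
  refine ⟨t, ht, ?_⟩
  have hcard : Fintype.card (𝒳 × 𝒴) = d ^ 2 := by rw [Fintype.card_prod, hcX, hcY, sq]
  rw [hcard] at htle
  have hd2 : 1 ≤ d ^ 2 := hsize.one_le
  have h1 : t ≤ 152 * d ^ 4 * (⌊τ⌋₊ + 1) := by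
    refine htle.trans ?_
    -- Copying a row and storing it cost `d ^ 2 + 1`, which raises `150` to `152`.
    have : 150 * d ^ 2 * (⌊τ⌋₊ + 1) + d ^ 2 + 1 ≤ 152 * d ^ 2 * (⌊τ⌋₊ + 1) := by
      nlinarith [Nat.zero_le (d ^ 2 * ⌊τ⌋₊)]
    calc _ ≤ d ^ 2 * (152 * d ^ 2 * (⌊τ⌋₊ + 1)) := Nat.mul_le_mul_left _ this
      _ = _ := by ring
  have h2 : (⌊τ⌋₊ : ℝ) ≤ τ := Nat.floor_le hτ0
  have h3 := two_add_le_mul_pow hξh hlogd hlogb hε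
  calc (t : ℝ) ≤ 152 * (d : ℝ) ^ 4 * (⌊τ⌋₊ + 1) := by exact_mod_cast h1
    _ ≤ 152 * (d : ℝ) ^ 4 * (514 * (max 1 ε⁻¹) ^ 4 * (1 + Real.log d + ξ * ‖h‖) *
          (1 + ξ * ‖h‖ + Real.log b⁻¹) ^ 2) := by
        gcongr
        refine le_trans ?_ h3
        rw [Real.log_inv, ← sub_eq_add_neg]
        linarith
    _ = _ := by ring
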